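/- For $a,q\in\mathbb{C}$ with $|q|<1$ let $(a;q)_\infty:=\prod_{j\ge 0}(1-aq^j)$, and for $z\ne 0$ let $$\theta(z;q):=(-z;q)_\infty\,(-z^{-1}q;q)_\infty\,(q;q)_\infty .$$ A partition satisfies the level $3$ gap condition if successive parts differ by at least $2$, and two parts differ by $2$ or $3$ only if their sum is a multiple of $3$. Let $\nu_j(\lambda)$ be the number of parts of $\lambda$ congruent to $j$ modulo $3$, let $|\lambda|$ be the sum of the parts of $\lambda$, and for $m\ge 1$ put $$C_m(t;q):=\sum_{\lambda} t^{\nu_1(\lambda)-\nu_2(\lambda)}q^{|\lambda|},$$ where $\lambda$ runs over all partitions (including the empty one) that satisfy the level $3$ gap condition and have all parts at least $m$. Put $$C_2^*(t;q):=C_1(t;q)-C_2(t;q)+C_3(t;q),$$ which is the analogous generating function for the partitions that satisfy the level $3$ gap condition and do not contain $2$ as a part. Let $\chi_3(k):=\left(\frac{k+1}{3}\right)$ (Legendre symbol) and $$\Theta_1(t;q):=\sum_{k\ge 0}\chi_3(k)\,t^{-k}q^{k(k+1)},\qquad \Theta_2(t;q):=\sum_{k\ge 0}\chi_3(k)\,t^{k}q^{k^2}.$$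 **Theorem.** Let $t,q\in\mathbb{C}$ with $t\neq 0$ and $0<|q|<1$. Then the series defining $C_m(t;q)$ ($m\ge1$), $\Theta_1(t;q)$ and $\Theta_2(t;q)$ converge absolutely, and $$C_1(t;q)=(-q^3;q^3)_\infty\,\theta(-t^2q^2;q^6)+C_2(t;q)\bigl(1-\Theta_1(t;q)\bigr)+C_2^*(t;q)\bigl(1-\Theta_2(t;q)\bigr),$$ $$C_3(t;q)=-(-q^3;q^3)_\infty\,\theta(-t^2q^2;q^6)+C_2(t;q)\,\Theta_1(t;q)+C_2^*(t;q)\,\Theta_2(t;q).$$ -/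

import Mathlib

namespace Capparelli

noncomputable section

/-- The level `3` gap condition: successive parts (listed in weakly decreasing order) differ by at
least `2`, and two parts differ by `2` or `3` only if their sum is a multiple of `3`. -/
def LevelThreeGap {n : ℕ} (p : n.Partition) : Prop :=
  (p.parts.sort (· ≥ ·)).IsChain (fun a b => b + 2 ≤ a) ∧
    ∀ a ∈ p.parts, ∀ b ∈ p.parts, (a = b + 2 ∨ a = b + 3) → 3 ∣ a + b

/-- `ν_j(λ)`: the number of parts of `λ` (with multiplicity) that are congruent to `j` mod `3`. -/
def nu (j : ℕ) {n : ℕ} (p : n.Partition) : ℕ :=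
  p.parts.countP (fun a => a ≡ j [MOD 3])

/-- All partitions (of any size, the empty partition included) that satisfy the level `3` gap
condition and have all parts at least `m`. -/
def GapPartition (m : ℕ) : Type :=
  {p : Σ n : ℕ, n.Partition // LevelThreeGap p.2 ∧ ∀ a ∈ p.2.parts, m ≤ a}

/-- The term `t^(ν₁(λ) - ν₂(λ)) q^|λ|`; the exponent of `t` is an integer. -/
def weight (t q : ℂ) {m : ℕ} (p : GapPartition m) : ℂ :=
  t ^ ((nu 1 p.1.2 : ℤ) - (nu 2 p.1.2 : ℤ)) * q ^ p.1.1

/-- The refined generating function `C_m(t;q)`. -/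
def C (m : ℕ) (t q : ℂ) : ℂ := ∑' p : GapPartition m, weight t q p

/-- The refined generating function `C₂*(t;q)` for partitions without `2` as a part. -/
def C2star (t q : ℂ) : ℂ := C 1 t q - C 2 t q + C 3 t q

/-- The infinite `q`-factorial `(a;q)_∞ = ∏_{j ≥ 0} (1 - a q^j)`. -/
def qPochInf (a q : ℂ) : ℂ := ∏' j : ℕ, (1 - a * q ^ j)

/-- The product defining `(a;q)_∞` converges for `|q| < 1`. -/
theorem multipliable_qPochInf (a : ℂ) {q : ℂ} (hq : ‖q‖ < 1) :
    Multipliable (fun j : ℕ => 1 - a * q ^ j) := by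
  have h : Summable (fun j : ℕ => ‖-(a * q ^ j)‖) := by
    simpa [norm_mul, norm_pow] using
      (summable_geometric_of_lt_one (norm_nonneg q) hq).mul_left ‖a‖
  simpa [sub_eq_add_neg] using multipliable_one_add_of_summable h

/-- The Jacobi theta function `θ(z;q) = (-z, -z⁻¹q, q; q)_∞`. -/
def theta (z q : ℂ) : ℂ :=
  qPochInf (-z) q * qPochInf (-(z⁻¹ * q)) q * qPochInf q q

/-- The shifted character `χ₃(m) = ((m+1)/3)` (Legendre symbol). -/
def chi3 (m : ℕ) : ℤ := legendreSym 3 ((m : ℤ) + 1)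

/-- The terms of `Θ₁(t;q)`. -/
def Theta1Term (t q : ℂ) (k : ℕ) : ℂ := (chi3 k : ℂ) * t ^ (-(k : ℤ)) * q ^ (k * (k + 1))

/-- The terms of `Θ₂(t;q)`. -/
def Theta2Term (t q : ℂ) (k : ℕ) : ℂ := (chi3 k : ℂ) * t ^ k * q ^ (k ^ 2)

/-- The false theta function `Θ₁(t;q) = ∑_{k ≥ 0} χ₃(k) t^{-k} q^{k(k+1)}`. -/
def Theta1 (t q : ℂ) : ℂ := ∑' k : ℕ, Theta1Term t q k

/-- The false theta function `Θ₂(t;q) = ∑_{k ≥ 0} χ₃(k) t^k q^{k²}`. -/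
def Theta2 (t q : ℂ) : ℂ := ∑' k : ℕ, Theta2Term t q k

end

end Capparelli

/-!
The argument compares both sides through explicit `q`-series, with `Q = q³`, `p = Q² = q⁶`, `a = tq`
and `b = t⁻¹q²`, so that `ab = Q`.

Write `A_k`, `D_k`, `E_k` for the generating functions of the gap partitions with parts at least
`3k+3`, with parts at least `3k+2`, and with parts at least `3k+1` but without the part `3k+2`.
Removing the smallest part gives
`D_k = A_k + b Q^k E_{k+1}`, `E_k = A_k + a Q^k D_{k+1}` and
`A_k = D_{k+1} + E_{k+1} - (1 - Q^{k+1}) A_{k+1}`.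
All three sequences tend to `1`, and this determines them (`recurrence_eq_zero`). The recurrence has
a solution in closed form, a double series over the numbers `i`, `j` of parts congruent to `1` and
`2` modulo `3` (`solTwo_eq`, `solThree_eq`), whence `C_eq_sol`: `C_2` is the series
`(-Q;Q)_∞ ∑ a^i b^j Q^{i²+j²-j} / ((p;p)_i (p;p)_j)`, and similarly for `C_2^*` and `C_3`, where
`C_3` carries an additional factor with denominator `1 + Q^{i+j}`.

Since `ab = Q`, the power of `t` in a term is `n = i - j`. Collecting the terms with given `n`, the
series for `C_2` and `C_2^*` reduce to theta series by Cauchy's identity (`solTwo_zero`). For `C_3`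
one finds a series in `y = Q^n` which satisfies a first-order functional equation, again by Cauchy's
identity (`tsum_coeffTerm`); iterating it yields the false theta series
`∑_{i ≥ 0} Q^{3i²+i+3ni} (1 - Q^{4i+2+2n})` as the coefficient (`hasSum_falseTheta`).

The terms with even `i` are those of the theta series of `C_2` times `Θ₁`. The terms with odd `i` are
the negatives of those of the theta series of `C_2^*` times the part of negative index of `Θ₂`, when
`Θ₂` is continued to a sum over all integers (`hasSum_coeff`). Finally the theta series of `C_2^*`
times the complete two-sided series is `(q⁶;q⁶)_∞ θ(-t²q²;q⁶)` (`tsum_starTerm_mul`): its coefficients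
vanish at odd powers of `t`, and those at even powers reduce to Euler's pentagonal number theorem.
This proves the formula for `C_3`, and the one for `C_1` follows from `C_2^* = C_1 - C_2 + C_3`.
-/

/-! ### Gap partitions as finite sets of positive integers -/

namespace Capparelli

/-- The level `3` gap condition for a finite set of parts. -/
def GapSet (S : Finset ℕ) : Prop :=
  ∀ a ∈ S, ∀ b ∈ S, b < a → b + 2 ≤ a ∧ ((a = b + 2 ∨ a = b + 3) → 3 ∣ a + b)

/-- The gap sets all of whose elements are at least `m`. -/
def GapSetFrom (m : ℕ) : Set (Finset ℕ) :=
  {S | GapSet S ∧ ∀ a ∈ S, m ≤ a}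

/-- The weight of a single part `a`: the factor `t`, `t⁻¹` or `1` according to the residue of `a`
modulo `3`, times `q ^ a`. -/
noncomputable def partWeight (t q : ℂ) (a : ℕ) : ℂ :=
  t ^ ((if a ≡ 1 [MOD 3] then 1 else 0 : ℤ) - (if a ≡ 2 [MOD 3] then 1 else 0)) * q ^ a

/-- The weight of a finite set of parts. -/
noncomputable def setWeight (t q : ℂ) (S : Finset ℕ) : ℂ := ∏ a ∈ S, partWeight t q a

theorem levelThreeGap_pairwise {n : ℕ} {p : n.Partition} (h : LevelThreeGap p) :
    (p.parts.sort (· ≥ ·)).Pairwise (fun a b => b + 2 ≤ a) := by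
  have : IsTrans ℕ (fun a b => b + 2 ≤ a) := ⟨fun a b c h1 h2 => by omega⟩
  exact List.isChain_iff_pairwise.mp h.1

theorem levelThreeGap_nodup {n : ℕ} {p : n.Partition} (h : LevelThreeGap p) : p.parts.Nodup := by
  have h1 := levelThreeGap_pairwise h
  have h2 : (p.parts.sort (· ≥ ·)).Nodup := h1.imp (by intro a b hab; omega)
  rw [← Multiset.sort_eq p.parts (· ≥ ·)]
  exact Multiset.coe_nodup.mpr h2

theorem levelThreeGap_gapSet {n : ℕ} {p : n.Partition} (h : LevelThreeGap p) :
    GapSet p.parts.toFinset := by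
  have h1 := levelThreeGap_pairwise h
  intro a ha b hb hab
  rw [Multiset.mem_toFinset] at ha hb
  refine ⟨?_, h.2 a ha b hb⟩
  have h3 : (p.parts.sort (· ≥ ·)).Pairwise (fun a b => a + 2 ≤ b ∨ b + 2 ≤ a) :=
    h1.imp (fun h => Or.inr h)
  have : Std.Symm (fun a b : ℕ => a + 2 ≤ b ∨ b + 2 ≤ a) := ⟨fun _ _ h => h.symm⟩
  have h4 := h3.forall (by simpa using ha) (by simpa using hb) hab.ne'
  omega

theorem gapSet_levelThreeGap {n : ℕ} {p : n.Partition} (hn : p.parts.Nodup)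
    (h : GapSet p.parts.toFinset) : LevelThreeGap p := by
  refine ⟨?_, fun a ha b hb hab => ?_⟩
  · have h2 : (p.parts.sort (· ≥ ·)).Pairwise (fun a b => b ≤ a) :=
      Multiset.pairwise_sort _ _
    have h3 : (p.parts.sort (· ≥ ·)).Nodup := by
      rw [← Multiset.coe_nodup, Multiset.sort_eq]; exact hn
    apply List.Pairwise.isChain
    refine (List.Pairwise.and h2 h3).imp_of_mem ?_
    intro a b ha hb hab
    exact (h a (by simpa using ha) b (by simpa using hb) (lt_of_le_of_ne hab.1 hab.2.symm)).1
  · exact (h a (by simpa using ha) b (by simpa using hb) (by omega)).2 hab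

theorem sigma_partition_ext {x y : Σ n : ℕ, n.Partition} (h : x.2.parts = y.2.parts) : x = y := by
  obtain ⟨n, p⟩ := x
  obtain ⟨k, r⟩ := y
  have hnk : n = k := by rw [← p.parts_sum, ← r.parts_sum]; exact congrArg Multiset.sum h
  subst hnk
  exact congrArg _ (Nat.Partition.ext h)

/-- Gap partitions with parts at least `m ≥ 1` correspond to their sets of parts. -/
noncomputable def gapPartitionEquiv (m : ℕ) (hm : 1 ≤ m) : GapPartition m ≃ GapSetFrom m where
  toFun p := ⟨p.1.2.parts.toFinset, levelThreeGap_gapSet p.2.1,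
    fun a ha => p.2.2 a (Multiset.mem_toFinset.mp ha)⟩
  invFun S := ⟨⟨∑ a ∈ S.1, a, ⟨S.1.val, fun {i} hi => lt_of_lt_of_le hm (S.2.2 i hi), by
      rw [Finset.sum, Multiset.map_id']⟩⟩,
    gapSet_levelThreeGap S.1.nodup (by simpa using S.2.1), fun a ha => S.2.2 a ha⟩
  left_inv := by
    rintro ⟨⟨n, ⟨parts, hpos, hsum⟩⟩, h⟩
    have hn := levelThreeGap_nodup h.1
    subst hsum
    have : parts.toFinset.val = parts := by simpa using hn.dedup
    exact Subtype.ext (sigma_partition_ext this)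
  right_inv := by
    rintro ⟨S, hS⟩
    simp

theorem zpow_sum_eq_prod {ι : Type*} {t : ℂ} (ht : t ≠ 0) (s : Finset ι) (f : ι → ℤ) :
    t ^ (∑ i ∈ s, f i) = ∏ i ∈ s, t ^ f i := by
  classical
  induction s using Finset.induction_on with
  | empty => simp
  | insert i s hi ih => rw [Finset.sum_insert hi, Finset.prod_insert hi, zpow_add₀ ht, ih]

theorem weight_eq_setWeight {t q : ℂ} (ht : t ≠ 0) {m : ℕ} (hm : 1 ≤ m) (p : GapPartition m) :
    weight t q p = setWeight t q (gapPartitionEquiv m hm p).1 := by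
  obtain ⟨⟨n, p⟩, h⟩ := p
  have hn := levelThreeGap_nodup h.1
  have h1 : (nu 1 p : ℤ) = ∑ a ∈ p.parts.toFinset, if a ≡ 1 [MOD 3] then 1 else 0 := by
    rw [nu, Finset.sum_boole, Multiset.countP_eq_card_filter, Finset.card, Finset.filter_val]
    simp [hn.dedup]
  have h2 : (nu 2 p : ℤ) = ∑ a ∈ p.parts.toFinset, if a ≡ 2 [MOD 3] then 1 else 0 := by
    rw [nu, Finset.sum_boole, Multiset.countP_eq_card_filter, Finset.card, Finset.filter_val]
    simp [hn.dedup]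
  have h3 : n = ∑ a ∈ p.parts.toFinset, a := by
    conv_lhs => rw [← p.parts_sum]
    rw [Finset.sum]; simp [hn.dedup]
  simp only [weight, setWeight, gapPartitionEquiv, partWeight]
  change _ = ∏ a ∈ p.parts.toFinset, _
  rw [Finset.prod_mul_distrib, h1, h2, ← Finset.sum_sub_distrib, Finset.prod_pow_eq_pow_sum, ← h3,
    zpow_sum_eq_prod ht]

theorem summable_norm_partWeight (t : ℂ) {q : ℂ} (hq : ‖q‖ < 1) :
    Summable (fun a => ‖partWeight t q a‖) := by
  have h : Summable (fun a : ℕ => (1 + ‖t‖ + ‖t⁻¹‖) * ‖q‖ ^ a) :=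
    (summable_geometric_of_lt_one (norm_nonneg q) hq).mul_left _
  refine h.of_nonneg_of_le (fun _ => norm_nonneg _) fun a => ?_
  rw [partWeight, norm_mul, norm_pow]
  refine mul_le_mul_of_nonneg_right ?_ (by positivity)
  have := norm_nonneg t
  have := norm_nonneg t⁻¹
  split_ifs <;> norm_num [-norm_inv] <;> linarith

theorem summable_norm_setWeight (t : ℂ) {q : ℂ} (hq : ‖q‖ < 1) :
    Summable (fun S => ‖setWeight t q S‖) := by
  simpa [setWeight, norm_prod] using summable_finsetProd_of_summable_nonneg
    (fun a => norm_nonneg (partWeight t q a)) (summable_norm_partWeight t hq)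

/-- The generating function of a set of finite sets of parts. -/
noncomputable def genFun (t q : ℂ) (X : Set (Finset ℕ)) : ℂ := ∑' S : X, setWeight t q S

theorem C_eq_genFun {t q : ℂ} (ht : t ≠ 0) {m : ℕ} (hm : 1 ≤ m) :
    C m t q = genFun t q (GapSetFrom m) := by
  rw [C, genFun, ← (gapPartitionEquiv m hm).tsum_eq]
  exact tsum_congr fun p => weight_eq_setWeight ht hm p

theorem summable_weight {t q : ℂ} (ht : t ≠ 0) (hq : ‖q‖ < 1) {m : ℕ} (hm : 1 ≤ m) :
    Summable (fun p : GapPartition m => weight t q p) := by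
  have h : Summable (fun S : GapSetFrom m => setWeight t q S.1) :=
    (summable_norm_setWeight t hq).of_norm.subtype _
  refine ((gapPartitionEquiv m hm).summable_iff.mpr h).congr fun p => ?_
  exact (weight_eq_setWeight ht hm p).symm

/-- A family of sets of parts splits into those members that avoid the part `m` and those that
contain it; removing `m` turns the latter into a family `Z` of sets not containing `m`. -/
theorem genFun_split (t : ℂ) {q : ℂ} (hq : ‖q‖ < 1) {X Y Z : Set (Finset ℕ)} (m : ℕ)
    (hY : ∀ S, S ∈ Y ↔ S ∈ X ∧ m ∉ S) (hZ : ∀ S, S ∈ Z ↔ m ∉ S ∧ insert m S ∈ X) :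
    genFun t q X = genFun t q Y + partWeight t q m * genFun t q Z := by
  have hs := (summable_norm_setWeight t hq).of_norm
  have hX : X = Y ∪ (insert m '' Z) := by
    ext S
    simp only [Set.mem_union, hY, Set.mem_image, hZ]
    constructor
    · intro h
      by_cases hm : m ∈ S
      · exact Or.inr ⟨S.erase m, by simp [Finset.insert_erase hm, h], Finset.insert_erase hm⟩
      · exact Or.inl ⟨h, hm⟩
    · rintro (h | ⟨T, h, rfl⟩)
      · exact h.1
      · exact h.2
  have hd : Disjoint Y (insert m '' Z) := by
    rw [Set.disjoint_left]
    rintro S hS ⟨T, -, rfl⟩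
    exact ((hY _).mp hS).2 (Finset.mem_insert_self m T)
  have hinj : Set.InjOn (insert m) Z := by
    intro S hS T hT h
    rw [← Finset.erase_insert ((hZ S).mp hS).1, ← Finset.erase_insert ((hZ T).mp hT).1]
    exact congrArg (fun U => Finset.erase U m) h
  rw [genFun, hX, Summable.tsum_union_disjoint hd (hs.subtype _) (hs.subtype _), genFun, genFun,
    tsum_image (setWeight t q) hinj, ← tsum_mul_left]
  congr 1
  refine tsum_congr fun S => ?_
  rw [setWeight, Finset.prod_insert ((hZ S.1).mp S.2).1, setWeight]

theorem partWeight_zero_mod (t q : ℂ) (k : ℕ) : partWeight t q (3 * k) = q ^ (3 * k) := by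
  simp [partWeight, Nat.ModEq]

theorem partWeight_one_mod (t q : ℂ) (k : ℕ) :
    partWeight t q (3 * k + 1) = t * q ^ (3 * k + 1) := by
  simp [partWeight, Nat.ModEq, Nat.add_mod]

theorem partWeight_two_mod (t q : ℂ) (k : ℕ) :
    partWeight t q (3 * k + 2) = t⁻¹ * q ^ (3 * k + 2) := by
  simp [partWeight, Nat.ModEq, Nat.add_mod]

theorem gapSet_insert {m : ℕ} {S : Finset ℕ} (hS : ∀ a ∈ S, m < a) :
    GapSet (insert m S) ↔ GapSet S ∧
      ∀ a ∈ S, m + 2 ≤ a ∧ ((a = m + 2 ∨ a = m + 3) → 3 ∣ a + m) := by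
  constructor
  · intro h
    exact ⟨fun a ha b hb => h a (by simp [ha]) b (by simp [hb]),
      fun a ha => h a (by simp [ha]) m (by simp) (hS a ha)⟩
  · rintro ⟨h1, h2⟩ a ha b hb hab
    obtain rfl | ha' := Finset.mem_insert.mp ha
    · rcases Finset.mem_insert.mp hb with rfl | hb
      · omega
      · have := hS b hb
        omega
    · rcases Finset.mem_insert.mp hb with rfl | hb
      · exact h2 a ha'
      · exact h1 a ha' b hb hab

theorem mem_gapSetFrom_succ (m : ℕ) (S : Finset ℕ) :
    S ∈ GapSetFrom (m + 1) ↔ S ∈ GapSetFrom m ∧ m ∉ S := by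
  constructor
  · rintro ⟨h1, h2⟩
    exact ⟨⟨h1, fun a ha => by have := h2 a ha; omega⟩, fun h => by have := h2 m h; omega⟩
  · rintro ⟨⟨h1, h2⟩, h3⟩
    refine ⟨h1, fun a ha => Nat.lt_of_le_of_ne (h2 a ha) ?_⟩
    rintro rfl
    exact h3 ha

theorem insert_mem_gapSetFrom (m : ℕ) (S : Finset ℕ) :
    (m ∉ S ∧ insert m S ∈ GapSetFrom m) ↔
      GapSet S ∧ ∀ a ∈ S, m + 2 ≤ a ∧ ((a = m + 2 ∨ a = m + 3) → 3 ∣ a + m) := by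
  constructor
  · rintro ⟨h1, h2, h3⟩
    refine (gapSet_insert fun a ha => ?_).mp h2
    refine lt_of_le_of_ne (h3 a (by simp [ha])) ?_
    rintro rfl
    exact h1 ha
  · rintro ⟨h1, h2⟩
    have h3 : ∀ a ∈ S, m < a := fun a ha => by have := h2 a ha; omega
    refine ⟨fun h => lt_irrefl _ (h3 m h), (gapSet_insert h3).mpr ⟨h1, h2⟩, fun a ha => ?_⟩
    rcases Finset.mem_insert.mp ha with rfl | ha
    · exact le_rfl
    · exact (h3 a ha).le

theorem genFun_zero_mod (t : ℂ) {q : ℂ} (hq : ‖q‖ < 1) (k : ℕ) :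
    genFun t q (GapSetFrom (3 * k)) = genFun t q (GapSetFrom (3 * k + 1)) +
      q ^ (3 * k) * genFun t q (GapSetFrom (3 * k + 3)) := by
  rw [← partWeight_zero_mod t q k]
  refine genFun_split t hq (3 * k) (mem_gapSetFrom_succ _) fun S => ?_
  rw [insert_mem_gapSetFrom]
  exact and_congr_right fun _ => forall₂_congr fun a _ => by omega

theorem genFun_one_mod (t : ℂ) {q : ℂ} (hq : ‖q‖ < 1) (k : ℕ) :
    genFun t q (GapSetFrom (3 * k + 1)) = genFun t q (GapSetFrom (3 * k + 2)) +
      t * q ^ (3 * k + 1) * genFun t q (GapSetFrom (3 * k + 5)) := by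
  rw [← partWeight_one_mod t q k]
  refine genFun_split t hq (3 * k + 1) (mem_gapSetFrom_succ _) fun S => ?_
  rw [insert_mem_gapSetFrom]
  exact and_congr_right fun _ => forall₂_congr fun a _ => by omega

/-- A smallest part `3k+2` may be followed by `3k+4`, which then has to be followed by at least
`3k+8`, or else by at least `3k+6`. -/
theorem genFun_two_mod (t : ℂ) {q : ℂ} (hq : ‖q‖ < 1) (k : ℕ) :
    genFun t q (GapSetFrom (3 * k + 2)) = genFun t q (GapSetFrom (3 * k + 3)) +
      t⁻¹ * q ^ (3 * k + 2) * (genFun t q (GapSetFrom (3 * k + 6)) +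
        t * q ^ (3 * k + 4) * genFun t q (GapSetFrom (3 * k + 8))) := by
  rw [← partWeight_two_mod t q k, show 3 * k + 4 = 3 * (k + 1) + 1 by ring,
    ← partWeight_one_mod t q (k + 1)]
  rw [← genFun_split t hq (X := {S | GapSet S ∧ ∀ a ∈ S, 3 * k + 2 + 2 ≤ a ∧
    ((a = 3 * k + 2 + 2 ∨ a = 3 * k + 2 + 3) → 3 ∣ a + (3 * k + 2))}) (3 * (k + 1) + 1)]
  · refine genFun_split t hq (3 * k + 2) (mem_gapSetFrom_succ _) fun S => ?_
    rw [insert_mem_gapSetFrom]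
    rfl
  · intro S
    constructor
    · rintro ⟨h1, h2⟩
      refine ⟨⟨h1, fun a ha => ?_⟩, fun h => ?_⟩
      · have := h2 a ha
        omega
      · have := h2 _ h
        omega
    · rintro ⟨⟨h1, h2⟩, h3⟩
      refine ⟨h1, fun a ha => ?_⟩
      have h4 := h2 a ha
      have h5 : a ≠ 3 * (k + 1) + 1 := by
        rintro rfl
        exact h3 ha
      omega
  · intro S
    constructor
    · rintro ⟨h1, h2⟩
      have h3 : ∀ a ∈ S, 3 * (k + 1) + 1 < a := fun a ha => by have := h2 a ha; omega
      refine ⟨fun h => lt_irrefl _ (h3 _ h), (gapSet_insert h3).mpr ⟨h1, fun a ha => ?_⟩,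
        fun a ha => ?_⟩
      · have := h2 a ha
        omega
      · rcases Finset.mem_insert.mp ha with rfl | ha
        · omega
        · have := h2 a ha
          omega
    · rintro ⟨h1, h2, h3⟩
      have h4 : ∀ a ∈ S, 3 * (k + 1) + 1 < a := fun a ha => by
        have h5 := (h3 a (by simp [ha]))
        have h6 : a ≠ 3 * (k + 1) + 1 := by
          rintro rfl
          exact h1 ha
        omega
      obtain ⟨h5, h6⟩ := (gapSet_insert h4).mp h2
      refine ⟨h5, fun a ha => ?_⟩
      have := h6 a ha
      omega

/-- As the smallest admissible part tends to infinity, only the empty partition survives. -/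
theorem tendsto_genFun (t : ℂ) {q : ℂ} (hq : ‖q‖ < 1) :
    Filter.Tendsto (fun m => genFun t q (GapSetFrom m)) Filter.atTop (nhds 1) := by
  have h1 : ∀ m, genFun t q (GapSetFrom m) =
      ∑' S, (GapSetFrom m).indicator (setWeight t q) S := fun m => tsum_subtype _ _
  have h2 : (1 : ℂ) = ∑' S : Finset ℕ, if S = ∅ then 1 else 0 := by simp
  simp_rw [h1]
  rw [h2]
  refine tendsto_tsum_of_dominated_convergence (summable_norm_setWeight t hq) (fun S => ?_)
    (Filter.Eventually.of_forall fun m S => norm_indicator_le_norm_self _ _)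
  refine tendsto_const_nhds.congr' ?_
  filter_upwards [Filter.eventually_gt_atTop (S.sup id)] with m hm
  split_ifs with hS
  · subst hS
    rw [Set.indicator_of_mem]
    · simp [setWeight]
    · exact ⟨fun a ha => by simp at ha, fun a ha => by simp at ha⟩
  · obtain ⟨a, ha⟩ := Finset.nonempty_iff_ne_empty.mpr hS
    rw [Set.indicator_of_notMem]
    intro h
    have h3 := h.2 a ha
    have h4 : a ≤ S.sup id := Finset.le_sup (f := id) ha
    omega

end Capparelli

/-! ### Infinite products and summability -/

namespace Capparelli

open Filter Topology

/-- The finite `q`-factorial `(p;p)_j = ∏_{i=1}^{j} (1 - p^i)`. -/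
noncomputable def qFactorial (p : ℂ) (j : ℕ) : ℂ := ∏ i ∈ Finset.range j, (1 - p ^ (i + 1))

theorem qFactorial_zero (p : ℂ) : qFactorial p 0 = 1 := by simp [qFactorial]

theorem qFactorial_succ (p : ℂ) (j : ℕ) :
    qFactorial p (j + 1) = qFactorial p j * (1 - p ^ (j + 1)) := by
  simp [qFactorial, Finset.prod_range_succ]

theorem one_sub_pow_ne_zero {p : ℂ} (hp : ‖p‖ < 1) (j : ℕ) : 1 - p ^ (j + 1) ≠ 0 := by
  intro h
  have h1 : ‖p‖ ^ (j + 1) = 1 := by rw [← norm_pow, ← sub_eq_zero.mp h, norm_one]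
  exact (pow_lt_one₀ (norm_nonneg p) hp (Nat.succ_ne_zero j)).ne h1

theorem qFactorial_ne_zero {p : ℂ} (hp : ‖p‖ < 1) (j : ℕ) : qFactorial p j ≠ 0 :=
  Finset.prod_ne_zero_iff.mpr fun i _ => one_sub_pow_ne_zero hp i

theorem norm_qPochInf_sub_one_le (z : ℂ) {p : ℂ} (hp : ‖p‖ < 1) :
    ‖qPochInf z p - 1‖ ≤ Real.exp (‖z‖ / (1 - ‖p‖)) - 1 := by
  have h1 := (multipliable_qPochInf z hp).tendsto_prod_tprod_nat
  refine le_of_tendsto ((h1.sub_const 1).norm) (Eventually.of_forall fun n => ?_)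
  have h2 := Finset.norm_prod_one_add_sub_one_le (Finset.range n) (fun j => -(z * p ^ j))
  simp only [← sub_eq_add_neg] at h2
  refine h2.trans ?_
  gcongr
  have h3 : ∀ j, ‖-(z * p ^ j)‖ = ‖z‖ * ‖p‖ ^ j := fun j => by rw [norm_neg, norm_mul, norm_pow]
  simp only [h3]
  have h4 := (hasSum_geometric_of_lt_one (norm_nonneg p) hp).mul_left ‖z‖
  exact sum_le_hasSum _ (fun _ _ => by positivity) h4

theorem norm_qPochInf_le (z : ℂ) {p : ℂ} (hp : ‖p‖ < 1) :
    ‖qPochInf z p‖ ≤ Real.exp (‖z‖ / (1 - ‖p‖)) := by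
  have h1 := norm_qPochInf_sub_one_le z hp
  have h2 := norm_sub_norm_le (qPochInf z p) 1
  rw [norm_one] at h2
  linarith

theorem norm_qPochInf_le_of_le {z p : ℂ} (hp : ‖p‖ < 1) {R : ℝ} (hz : ‖z‖ ≤ R) :
    ‖qPochInf z p‖ ≤ Real.exp (R / (1 - ‖p‖)) := by
  refine (norm_qPochInf_le z hp).trans (Real.exp_le_exp.mpr ?_)
  have : 0 < 1 - ‖p‖ := by linarith
  gcongr

theorem tendsto_qPochInf {p : ℂ} (hp : ‖p‖ < 1) {u : ℕ → ℂ} (hu : Tendsto u atTop (𝓝 0)) :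
    Tendsto (fun n => qPochInf (u n) p) atTop (𝓝 1) := by
  rw [tendsto_iff_norm_sub_tendsto_zero]
  have h1 : Tendsto (fun n => Real.exp (‖u n‖ / (1 - ‖p‖)) - 1) atTop (𝓝 0) := by
    have := (Real.continuous_exp.tendsto _).comp (hu.norm.div_const (1 - ‖p‖))
    simpa using this.sub_const 1
  exact squeeze_zero (fun _ => norm_nonneg _) (fun n => norm_qPochInf_sub_one_le _ hp) h1

theorem qPochInf_eq_mul (z : ℂ) {p : ℂ} (hp : ‖p‖ < 1) :
    qPochInf z p = (1 - z) * qPochInf (z * p) p := by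
  rw [qPochInf, tprod_eq_zero_mul']
  · simp only [pow_zero, mul_one, qPochInf]
    congr 1
    exact tprod_congr fun j => by ring
  · exact (multipliable_qPochInf (z * p) hp).congr fun j => by ring

theorem qPochInf_eq_prod_mul (z : ℂ) {p : ℂ} (hp : ‖p‖ < 1) (n : ℕ) :
    qPochInf z p = (∏ j ∈ Finset.range n, (1 - z * p ^ j)) * qPochInf (z * p ^ n) p := by
  induction n with
  | zero => simp
  | succ n ih =>
    rw [ih, Finset.prod_range_succ, qPochInf_eq_mul (z * p ^ n) hp, pow_succ]
    ring_nf

theorem qFactorial_mul_qPochInf {p : ℂ} (hp : ‖p‖ < 1) (n : ℕ) :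
    qFactorial p n * qPochInf (p ^ (n + 1)) p = qPochInf p p := by
  rw [qPochInf_eq_prod_mul p hp n, qFactorial, pow_succ']
  congr 1
  exact Finset.prod_congr rfl fun j _ => by ring

theorem qPochInf_eq_zero {z p : ℂ} (n : ℕ) (h : z * p ^ n = 1) : qPochInf z p = 0 :=
  tprod_of_exists_eq_zero ⟨n, by rw [h, sub_self]⟩

theorem qPochInf_ne_zero {z p : ℂ} (hp : ‖p‖ < 1) (h : ∀ j : ℕ, z * p ^ j ≠ 1) :
    qPochInf z p ≠ 0 := by
  have h1 : Summable (fun j : ℕ => ‖-(z * p ^ j)‖) := by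
    simpa [norm_mul, norm_pow] using
      (summable_geometric_of_lt_one (norm_nonneg p) hp).mul_left ‖z‖
  have h2 := tprod_one_add_ne_zero_of_summable (f := fun j : ℕ => -(z * p ^ j))
    (fun j => by rw [← sub_eq_add_neg]; exact sub_ne_zero.mpr (h j).symm) h1
  simp only [← sub_eq_add_neg] at h2
  exact h2

theorem qPochInf_self_ne_zero {p : ℂ} (hp : ‖p‖ < 1) : qPochInf p p ≠ 0 := by
  refine qPochInf_ne_zero hp fun j h => one_sub_pow_ne_zero hp j ?_
  rw [pow_succ', h, sub_self]

theorem exists_norm_inv_qFactorial_le {p : ℂ} (hp : ‖p‖ < 1) :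
    ∃ K : ℝ, 0 ≤ K ∧ ∀ j, ‖(qFactorial p j)⁻¹‖ ≤ K := by
  refine ⟨Real.exp (1 / (1 - ‖p‖)) * ‖(qPochInf p p)⁻¹‖, by positivity, fun j => ?_⟩
  have h1 : (qFactorial p j)⁻¹ = qPochInf (p ^ (j + 1)) p * (qPochInf p p)⁻¹ := by
    have h2 := qFactorial_mul_qPochInf hp j
    have h3 := qPochInf_self_ne_zero hp
    have h4 := qFactorial_ne_zero hp j
    field_simp
    rw [← h2]
  rw [h1, norm_mul]
  refine mul_le_mul_of_nonneg_right (norm_qPochInf_le_of_le hp ?_) (norm_nonneg _)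
  rw [norm_pow]
  exact pow_le_one₀ (norm_nonneg p) hp.le

theorem summable_pow_mul_pow_sq {c r : ℝ} (hc : 0 ≤ c) (hr0 : 0 ≤ r) (hr : r < 1) :
    Summable (fun i : ℕ => c ^ i * r ^ (i * i)) := by
  have h1 : Tendsto (fun i : ℕ => c * r ^ i) atTop (𝓝 0) := by
    simpa using (tendsto_pow_atTop_nhds_zero_of_lt_one hr0 hr).const_mul c
  have h2 : ∀ᶠ i in atTop, c * r ^ i ≤ 1 / 2 := h1.eventually_le_const (by norm_num)
  refine summable_of_isBigO_nat (summable_geometric_of_lt_one (r := 1 / 2) (by norm_num)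
    (by norm_num)) (Asymptotics.IsBigO.of_bound 1 ?_)
  filter_upwards [h2] with i hi
  rw [pow_mul, ← mul_pow, one_mul, Real.norm_of_nonneg (by positivity),
    Real.norm_of_nonneg (by positivity)]
  exact pow_le_pow_left₀ (by positivity) hi i

theorem summable_norm_zpow_mul_zpow_sq {c r : ℂ} (hr : ‖r‖ < 1) :
    Summable (fun n : ℤ => ‖c ^ n * r ^ (n * n)‖) := by
  refine Summable.of_nat_of_neg ?_ ?_
  · refine (summable_pow_mul_pow_sq (norm_nonneg c) (norm_nonneg r) hr).congr fun i => ?_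
    rw [norm_mul, norm_zpow, norm_zpow]
    norm_cast
  · refine (summable_pow_mul_pow_sq (norm_nonneg c⁻¹) (norm_nonneg r) hr).congr fun i => ?_
    rw [norm_mul, norm_zpow, norm_zpow, neg_mul_neg, zpow_neg, ← inv_zpow, norm_inv]
    norm_cast

/-- A telescoping series whose boundary terms vanish sums to zero. -/
theorem tsum_telescope_eq_zero {f G : ℕ → ℂ} (hf : Summable f) (h : ∀ j, f j = G (j + 1) - G j)
    (h0 : G 0 = 0) (hG : Tendsto G atTop (𝓝 0)) : ∑' j, f j = 0 := by
  refine HasSum.tsum_eq ?_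
  rw [hf.hasSum_iff_tendsto_nat]
  simp only [h, Finset.sum_range_sub, h0, sub_zero]
  exact hG

end Capparelli

/-! ### The summation formulas of Cauchy, Euler and Jacobi -/

namespace Capparelli

open Filter Topology

theorem norm_mul_inv_le {x y : ℂ} {a K : ℝ} (hx : ‖x‖ ≤ a) (hy : ‖y⁻¹‖ ≤ K) :
    ‖x / y‖ ≤ a * K := by
  rw [div_eq_mul_inv, norm_mul]
  exact mul_le_mul hx hy (norm_nonneg _) ((norm_nonneg x).trans hx)

/-- The `j`-th term of Cauchy's series, multiplied by `(zp;p)_∞`. -/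
noncomputable def cauchyTerm (z p : ℂ) (j : ℕ) : ℂ :=
  z ^ j * p ^ (j * j) * qPochInf (z * p ^ (j + 1)) p / qFactorial p j

theorem exists_norm_cauchyTerm_le {p : ℂ} (hp : ‖p‖ < 1) (R : ℝ) :
    ∃ K : ℝ, ∀ z : ℂ, ‖z‖ ≤ R → ∀ j, ‖cauchyTerm z p j‖ ≤ R ^ j * ‖p‖ ^ (j * j) * K := by
  obtain ⟨K, hK0, hK⟩ := exists_norm_inv_qFactorial_le hp
  refine ⟨Real.exp (R / (1 - ‖p‖)) * K, fun z hz j => ?_⟩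
  have hR : 0 ≤ R := (norm_nonneg z).trans hz
  rw [cauchyTerm, ← mul_assoc]
  refine norm_mul_inv_le ?_ (hK j)
  rw [norm_mul, norm_mul, norm_pow, norm_pow]
  gcongr
  refine norm_qPochInf_le_of_le hp ?_
  rw [norm_mul, norm_pow]
  calc ‖z‖ * ‖p‖ ^ (j + 1) ≤ R * 1 := by
        gcongr
        exact pow_le_one₀ (norm_nonneg p) hp.le
    _ = R := mul_one R

theorem summable_cauchyTerm (z : ℂ) {p : ℂ} (hp : ‖p‖ < 1) : Summable (cauchyTerm z p) := by
  obtain ⟨K, hK⟩ := exists_norm_cauchyTerm_le hp ‖z‖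
  exact ((summable_pow_mul_pow_sq (norm_nonneg z) (norm_nonneg p) hp).mul_right K).of_norm_bounded
    (hK z le_rfl)

theorem tendsto_pow_mul_zero (z : ℂ) {p : ℂ} (hp : ‖p‖ < 1) :
    Tendsto (fun n : ℕ => z * p ^ n) atTop (𝓝 0) := by
  simpa using (tendsto_pow_atTop_nhds_zero_of_norm_lt_one hp).const_mul z

theorem norm_mul_pow_le (z : ℂ) {p : ℂ} (hp : ‖p‖ < 1) (n : ℕ) : ‖z * p ^ n‖ ≤ ‖z‖ := by
  rw [norm_mul, norm_pow]
  exact mul_le_of_le_one_right (norm_nonneg z) (pow_le_one₀ (norm_nonneg p) hp.le)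

theorem tendsto_cauchyTerm {p : ℂ} (hp : ‖p‖ < 1) {u : ℕ → ℂ} (hu : Tendsto u atTop (𝓝 0))
    (j : ℕ) : Tendsto (fun n => cauchyTerm (u n) p j) atTop (𝓝 (if j = 0 then 1 else 0)) := by
  have h4 : Tendsto (fun n => qPochInf (u n * p ^ (j + 1)) p) atTop (𝓝 1) :=
    tendsto_qPochInf hp (by simpa using hu.mul_const (p ^ (j + 1)))
  have h5 := (((hu.pow j).mul_const (p ^ (j * j))).mul h4).div_const (qFactorial p j)
  have h6 : 0 ^ j * p ^ (j * j) * 1 / qFactorial p j = if j = 0 then 1 else 0 := by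
    rcases j with _ | j <;> simp [qFactorial_zero]
  rw [← h6]
  exact h5

theorem tsum_cauchyTerm_mul (z : ℂ) {p : ℂ} (hp : ‖p‖ < 1) :
    ∑' j, cauchyTerm z p j = ∑' j, cauchyTerm (z * p) p j := by
  have h1 := summable_cauchyTerm z hp
  have h2 := summable_cauchyTerm (z * p) hp
  rw [← sub_eq_zero, ← h1.tsum_sub h2]
  -- The termwise difference is `G (j + 1) - G j` for `G j = -(1 - p ^ j) * cauchyTerm z p j`, and
  -- `G 0 = 0`.
  refine tsum_telescope_eq_zero (h1.sub h2) (G := fun j => -((1 - p ^ j) * cauchyTerm z p j))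
    (fun j => ?_) (by simp) ?_
  · have h3 := qFactorial_ne_zero hp j
    have h4 := one_sub_pow_ne_zero hp j
    simp only [cauchyTerm]
    rw [qFactorial_succ, qPochInf_eq_mul (z * p ^ (j + 1)) hp, mul_assoc z (p ^ (j + 1)) p,
      ← pow_succ, show z * p * p ^ (j + 1) = z * p ^ (j + 1 + 1) by ring]
    field_simp
    ring
  · have h3 := h1.tendsto_atTop_zero
    have h4 : Tendsto (fun j : ℕ => 1 - p ^ j) atTop (𝓝 (1 - 0)) :=
      (tendsto_pow_atTop_nhds_zero_of_norm_lt_one hp).const_sub 1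
    simpa using (h4.mul h3).neg

/-- **Cauchy's identity** `∑_j z^j p^{j²} / ((p;p)_j (zp;p)_j) = 1 / (zp;p)_∞`, cleared of the
denominators that depend on `z`. -/
theorem hasSum_cauchyTerm (z : ℂ) {p : ℂ} (hp : ‖p‖ < 1) : HasSum (cauchyTerm z p) 1 := by
  have h1 : ∀ n : ℕ, ∑' j, cauchyTerm (z * p ^ n) p j = ∑' j, cauchyTerm z p j := by
    intro n
    induction n with
    | zero => simp
    | succ n ih => rw [pow_succ, ← mul_assoc, ← tsum_cauchyTerm_mul _ hp, ih]
  obtain ⟨K, hK⟩ := exists_norm_cauchyTerm_le hp ‖z‖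
  have h2 : Tendsto (fun n : ℕ => ∑' j, cauchyTerm (z * p ^ n) p j) atTop
      (𝓝 (∑' j : ℕ, if j = 0 then 1 else 0)) := by
    refine tendsto_tsum_of_dominated_convergence
      ((summable_pow_mul_pow_sq (norm_nonneg z) (norm_nonneg p) hp).mul_right K) (fun j => ?_)
      (Eventually.of_forall fun n j => hK _ (norm_mul_pow_le z hp n) j)
    exact tendsto_cauchyTerm hp (tendsto_pow_mul_zero z hp) j
  simp only [h1, tsum_ite_eq] at h2
  have h6 := tendsto_nhds_unique h2 tendsto_const_nhds
  rw [h6]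
  exact (summable_cauchyTerm z hp).hasSum

theorem norm_sq_lt_one {r : ℂ} (hr : ‖r‖ < 1) : ‖r ^ 2‖ < 1 := by
  rw [norm_pow]
  exact pow_lt_one₀ (norm_nonneg r) hr two_ne_zero

/-- The `i`-th term of Euler's series for `(-zr;r²)_∞`. -/
noncomputable def eulerTerm (z r : ℂ) (i : ℕ) : ℂ := z ^ i * r ^ (i * i) / qFactorial (r ^ 2) i

theorem exists_norm_eulerTerm_le {r : ℂ} (hr : ‖r‖ < 1) :
    ∃ K : ℝ, 0 ≤ K ∧ ∀ z i, ‖eulerTerm z r i‖ ≤ ‖z‖ ^ i * ‖r‖ ^ (i * i) * K := by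
  obtain ⟨K, hK0, hK⟩ := exists_norm_inv_qFactorial_le (norm_sq_lt_one hr)
  refine ⟨K, hK0, fun z i => norm_mul_inv_le ?_ (hK i)⟩
  rw [norm_mul, norm_pow, norm_pow]

theorem summable_norm_eulerTerm (z : ℂ) {r : ℂ} (hr : ‖r‖ < 1) :
    Summable (fun i => ‖eulerTerm z r i‖) := by
  obtain ⟨K, -, hK⟩ := exists_norm_eulerTerm_le hr
  exact ((summable_pow_mul_pow_sq (norm_nonneg z) (norm_nonneg r) hr).mul_right K).of_nonneg_of_le
    (fun _ => norm_nonneg _) (hK z)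

theorem tsum_eulerTerm_mul (z : ℂ) {r : ℂ} (hr : ‖r‖ < 1) :
    ∑' i, eulerTerm z r i = (1 + z * r) * ∑' i, eulerTerm (z * r ^ 2) r i := by
  have h1 := (summable_norm_eulerTerm z hr).of_norm
  have h2 := (summable_norm_eulerTerm (z * r ^ 2) hr).of_norm
  have h3 := h1.sub h2
  rw [add_mul, one_mul, add_comm, ← sub_eq_iff_eq_add, ← h1.tsum_sub h2, h3.tsum_eq_zero_add,
    ← tsum_mul_left]
  simp only [eulerTerm, pow_zero, qFactorial_zero, sub_self, zero_add]
  refine tsum_congr fun i => ?_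
  have h4 := qFactorial_ne_zero (norm_sq_lt_one hr) i
  have h5 := one_sub_pow_ne_zero (norm_sq_lt_one hr) i
  rw [qFactorial_succ]
  field_simp
  ring

/-- **Euler's identity** `∑_i z^i r^{i²} / (r²;r²)_i = (-zr;r²)_∞`. -/
theorem tsum_eulerTerm (z : ℂ) {r : ℂ} (hr : ‖r‖ < 1) :
    ∑' i, eulerTerm z r i = qPochInf (-(z * r)) (r ^ 2) := by
  have hp := norm_sq_lt_one hr
  have h1 : ∀ n : ℕ, ∑' i, eulerTerm z r i = (∏ j ∈ Finset.range n, (1 - -(z * r) * (r ^ 2) ^ j)) *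
      ∑' i, eulerTerm (z * (r ^ 2) ^ n) r i := by
    intro n
    induction n with
    | zero => simp
    | succ n ih =>
      rw [ih, Finset.prod_range_succ, tsum_eulerTerm_mul _ hr, pow_succ]
      ring_nf
  obtain ⟨K, hK0, hK⟩ := exists_norm_eulerTerm_le hr
  have h2 : Tendsto (fun n : ℕ => ∑' i, eulerTerm (z * (r ^ 2) ^ n) r i) atTop
      (𝓝 (∑' j : ℕ, if j = 0 then 1 else 0)) := by
    refine tendsto_tsum_of_dominated_convergence
      ((summable_pow_mul_pow_sq (norm_nonneg z) (norm_nonneg r) hr).mul_right K) (fun j => ?_)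
      (Eventually.of_forall fun n j => (hK _ j).trans ?_)
    · have h5 := (((tendsto_pow_mul_zero z hp).pow j).mul_const (r ^ (j * j))).div_const
        (qFactorial (r ^ 2) j)
      have h6 : 0 ^ j * r ^ (j * j) / qFactorial (r ^ 2) j = if j = 0 then 1 else 0 := by
        rcases j with _ | j <;> simp [qFactorial_zero]
      rw [← h6]
      exact h5
    · have := norm_mul_pow_le z hp n
      gcongr
  have h3 := (multipliable_qPochInf (-(z * r)) hp).tendsto_prod_tprod_nat.mul h2
  simp only [← h1, tsum_ite_eq, mul_one] at h3
  exact tendsto_nhds_unique tendsto_const_nhds h3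

/-- Regrouping a double series over `i, j ≥ 0` according to the difference `n = i - j`. -/
theorem hasSum_diff {f : ℕ × ℕ → ℂ} {g : ℤ → ℕ → ℂ} {h : ℤ → ℂ} {s : ℂ} (hf : HasSum f s)
    (hfg : ∀ i j : ℕ, g (i - j) j = f (i, j)) (hg : ∀ (n : ℤ) (j : ℕ), n + j < 0 → g n j = 0)
    (hgh : ∀ n, HasSum (g n) (h n)) : HasSum h s := by
  have hinj : Function.Injective (fun x : ℕ × ℕ => (((x.1 : ℤ) - x.2, x.2) : ℤ × ℕ)) := by
    rintro ⟨i, j⟩ ⟨k, l⟩ h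
    simp only [Prod.mk.injEq] at h ⊢
    omega
  have h1 : HasSum (fun x : ℤ × ℕ => g x.1 x.2) s := by
    refine (hinj.hasSum_iff ?_).mp (by simpa [Function.comp_def, hfg] using hf)
    rintro ⟨n, j⟩ hx
    refine hg n j ?_
    by_contra hlt
    refine hx ⟨((n + j).toNat, j), ?_⟩
    simp only [Prod.mk.injEq, and_true]
    omega
  exact h1.prod_fiberwise hgh

theorem qPochInf_zpow_eq_zero {p : ℂ} (hp0 : p ≠ 0) {n : ℤ} {j : ℕ} (h : n + j < 0) :
    qPochInf (p ^ n * p ^ (j + 1)) p = 0 := by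
  refine qPochInf_eq_zero (-(n + j + 1)).toNat ?_
  rw [← zpow_natCast, ← zpow_natCast, ← zpow_add₀ hp0, ← zpow_add₀ hp0]
  have : n + ((j + 1 : ℕ) : ℤ) + ((-(n + j + 1)).toNat : ℤ) = 0 := by
    push_cast
    omega
  rw [this, zpow_zero]

theorem zpow_sub_mul_self {r : ℂ} (hr : r ≠ 0) (i j : ℕ) :
    r ^ (((i : ℤ) - j) * ((i : ℤ) - j)) = r ^ (i * i) * r ^ (j * j) / (r ^ 2) ^ (i * j) := by
  rw [eq_div_iff (by positivity), ← pow_mul, ← pow_add]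
  simp only [← zpow_natCast]
  rw [← zpow_add₀ hr]
  congr 1
  push_cast
  ring

theorem zpow_sub_natCast {p : ℂ} (hp : p ≠ 0) (i j : ℕ) :
    p ^ ((i : ℤ) - j) = p ^ i / p ^ j := by
  rw [zpow_sub₀ hp, zpow_natCast, zpow_natCast]

theorem hasSum_eulerTerm_mul_eulerTerm (z w : ℂ) {r : ℂ} (hr : ‖r‖ < 1) :
    HasSum (fun x : ℕ × ℕ => eulerTerm z r x.1 * eulerTerm w r x.2)
      (qPochInf (-(z * r)) (r ^ 2) * qPochInf (-(w * r)) (r ^ 2)) := by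
  rw [← tsum_eulerTerm z hr, ← tsum_eulerTerm w hr,
    tsum_mul_tsum_of_summable_norm (summable_norm_eulerTerm z hr) (summable_norm_eulerTerm w hr)]
  exact (summable_mul_of_summable_norm (summable_norm_eulerTerm z hr)
    (summable_norm_eulerTerm w hr)).hasSum

/-- The terms of the product of two Euler series, regrouped according to `n = i - j`, are the terms
of Cauchy's series at `r^{2n}`. -/
theorem eulerTerm_mul_eq_cauchyTerm {z r : ℂ} (hz : z ≠ 0) (hr0 : r ≠ 0) (hr : ‖r‖ < 1)
    (i j : ℕ) :
    z ^ ((i : ℤ) - j) * r ^ (((i : ℤ) - j) * ((i : ℤ) - j)) *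
        cauchyTerm ((r ^ 2) ^ ((i : ℤ) - j)) (r ^ 2) j =
      qPochInf (r ^ 2) (r ^ 2) * (eulerTerm z r i * eulerTerm z⁻¹ r j) := by
  have hp := norm_sq_lt_one hr
  have hp0 : r ^ 2 ≠ 0 := pow_ne_zero 2 hr0
  have h1 := qFactorial_mul_qPochInf hp i
  have h2 := qFactorial_ne_zero hp i
  have h3 := qFactorial_ne_zero hp j
  have h4 : (r ^ 2) ^ ((i : ℤ) - j) * (r ^ 2) ^ (j + 1) = (r ^ 2) ^ (i + 1) := by
    rw [zpow_sub_natCast hp0, pow_succ (r ^ 2) j, pow_succ (r ^ 2) i]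
    field_simp
  simp only [cauchyTerm, eulerTerm]
  rw [h4, ← h1, zpow_sub_natCast hp0, zpow_sub_natCast hz, zpow_sub_mul_self hr0, div_pow,
    ← pow_mul, ← pow_mul (r ^ 2), inv_pow]
  field_simp
  ring

/-- **Jacobi's triple product identity**, from Euler's identity for the two products that involve
`z` and Cauchy's identity for the coefficient of `z^n`. -/
theorem hasSum_jacobi {z r : ℂ} (hz : z ≠ 0) (hr0 : r ≠ 0) (hr : ‖r‖ < 1) :
    HasSum (fun n : ℤ => z ^ n * r ^ (n * n))
      (qPochInf (r ^ 2) (r ^ 2) *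
        (qPochInf (-(z * r)) (r ^ 2) * qPochInf (-(z⁻¹ * r)) (r ^ 2))) := by
  have hp := norm_sq_lt_one hr
  have hp0 : r ^ 2 ≠ 0 := pow_ne_zero 2 hr0
  refine hasSum_diff (g := fun n j => z ^ n * r ^ (n * n) * cauchyTerm ((r ^ 2) ^ n) (r ^ 2) j)
    ((hasSum_eulerTerm_mul_eulerTerm z z⁻¹ hr).mul_left (qPochInf (r ^ 2) (r ^ 2)))
    (fun i j => eulerTerm_mul_eq_cauchyTerm hz hr0 hr i j) (fun n j hnj => ?_) (fun n => ?_)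
  · simp only [cauchyTerm, qPochInf_zpow_eq_zero hp0 hnj]
    simp
  · simpa using (hasSum_cauchyTerm ((r ^ 2) ^ n) hp).mul_left (z ^ n * r ^ (n * n))

end Capparelli

/-! ### Solving the recurrence of the gap conditions -/

namespace Capparelli

open Filter Topology

/-- The finite `q`-factorial `(-Q;Q)_n`. -/
noncomputable def negFactorial (Q : ℂ) (n : ℕ) : ℂ := ∏ l ∈ Finset.range n, (1 + Q ^ (l + 1))

theorem negFactorial_zero (Q : ℂ) : negFactorial Q 0 = 1 := by simp [negFactorial]

theorem negFactorial_succ (Q : ℂ) (n : ℕ) :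
    negFactorial Q (n + 1) = negFactorial Q n * (1 + Q ^ (n + 1)) := by
  simp [negFactorial, Finset.prod_range_succ]

theorem one_add_pow_ne_zero {Q : ℂ} (hQ : ‖Q‖ < 1) (n : ℕ) : 1 + Q ^ n ≠ 0 := by
  rcases n with _ | n
  · norm_num
  intro h
  have h1 : ‖Q‖ ^ (n + 1) = 1 := by
    rw [← norm_pow, ← norm_neg, ← eq_neg_of_add_eq_zero_left h, norm_one]
  exact (pow_lt_one₀ (norm_nonneg Q) hQ (Nat.succ_ne_zero n)).ne h1

theorem negFactorial_mul_qPochInf {Q : ℂ} (hQ : ‖Q‖ < 1) (n : ℕ) :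
    negFactorial Q n * qPochInf (-Q ^ (n + 1)) Q = qPochInf (-Q) Q := by
  rw [qPochInf_eq_prod_mul (-Q) hQ n, negFactorial, pow_succ', neg_mul]
  congr 1
  exact Finset.prod_congr rfl fun j _ => by ring

/-- The part of the explicit solution at level `k` that depends only on the number `n` of parts
not divisible by `3`: `(-Q;Q)_n Q^{kn} (-Q^{k+n+1};Q)_∞`. -/
noncomputable def levelFactor (Q : ℂ) (k n : ℕ) : ℂ :=
  negFactorial Q n * (Q ^ k) ^ n * qPochInf (-Q ^ (k + n + 1)) Q

theorem levelFactor_zero {Q : ℂ} (hQ : ‖Q‖ < 1) (n : ℕ) :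
    levelFactor Q 0 n = qPochInf (-Q) Q := by
  rw [levelFactor, pow_zero, one_pow, mul_one, zero_add, negFactorial_mul_qPochInf hQ]

theorem levelFactor_succ_right (Q : ℂ) (k n : ℕ) :
    levelFactor Q k (n + 1) * Q ^ n = (1 + Q ^ (n + 1)) * Q ^ k * levelFactor Q (k + 1) n := by
  rw [levelFactor, levelFactor, negFactorial_succ, show k + (n + 1) + 1 = k + 1 + n + 1 by ring]
  ring

theorem levelFactor_succ_left {Q : ℂ} (hQ : ‖Q‖ < 1) (k n : ℕ) :
    Q ^ n * levelFactor Q k n = (1 + Q ^ (k + n + 1)) * levelFactor Q (k + 1) n := by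
  rw [levelFactor, levelFactor, qPochInf_eq_mul _ hQ, neg_mul, ← pow_succ,
    show k + n + 1 + 1 = k + 1 + n + 1 by ring]
  ring

theorem exists_norm_levelFactor_le {Q : ℂ} (hQ : ‖Q‖ < 1) :
    ∃ K : ℝ, ∀ k n, ‖levelFactor Q k n‖ ≤ K := by
  have h1 : Tendsto (negFactorial Q) atTop (𝓝 (qPochInf (-Q) Q)) := by
    refine (multipliable_qPochInf (-Q) hQ).tendsto_prod_tprod_nat.congr fun n => ?_
    exact Finset.prod_congr rfl fun j _ => by ring
  obtain ⟨K, hK⟩ := (Metric.isBounded_range_of_tendsto _ h1).exists_norm_le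
  refine ⟨K * 1 * Real.exp (1 / (1 - ‖Q‖)), fun k n => ?_⟩
  have h2 := hK _ (Set.mem_range_self n)
  have h0 := (norm_nonneg _).trans h2
  have h3 : ∀ l : ℕ, ‖Q ^ l‖ ≤ 1 := fun l => by
    rw [norm_pow]
    exact pow_le_one₀ (norm_nonneg Q) hQ.le
  have h4 : ‖qPochInf (-Q ^ (k + n + 1)) Q‖ ≤ Real.exp (1 / (1 - ‖Q‖)) :=
    norm_qPochInf_le_of_le hQ (by rw [norm_neg]; exact h3 _)
  rw [levelFactor, norm_mul, norm_mul, ← pow_mul]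
  exact mul_le_mul (mul_le_mul h2 (h3 _) (norm_nonneg _) h0) h4 (norm_nonneg _) (by simpa using h0)

theorem tendsto_levelFactor {Q : ℂ} (hQ : ‖Q‖ < 1) (n : ℕ) :
    Tendsto (fun k => levelFactor Q k n) atTop (𝓝 (if n = 0 then 1 else 0)) := by
  have h0 := tendsto_pow_atTop_nhds_zero_of_norm_lt_one hQ
  have h1 : Tendsto (fun k => qPochInf (-Q ^ (k + n + 1)) Q) atTop (𝓝 1) := by
    refine tendsto_qPochInf hQ ?_
    have h4 := (h0.mul_const (Q ^ (n + 1))).neg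
    rw [zero_mul, neg_zero] at h4
    refine h4.congr fun k => ?_
    rw [← pow_add, add_assoc]
  have h2 := ((h0.pow n).const_mul (negFactorial Q n)).mul h1
  have h3 : negFactorial Q n * 0 ^ n * 1 = if n = 0 then 1 else 0 := by
    rcases n with _ | n <;> simp [negFactorial_zero]
  rw [← h3]
  exact h2

/-- A term of the explicit solution: it belongs to the partitions with `x.1` parts congruent to `1`
and `x.2` parts congruent to `2` modulo `3`. -/
noncomputable def solTerm (a b Q : ℂ) (x : ℕ × ℕ) : ℂ :=
  eulerTerm a Q x.1 * eulerTerm (b / Q) Q x.2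

/-- The explicit solution for the partitions whose parts are at least `3k+2`; exchanging `a` and
`b` gives the one for the parts at least `3k+1` and different from `3k+2`. -/
noncomputable def solTwo (a b Q : ℂ) (k : ℕ) : ℂ :=
  ∑' x : ℕ × ℕ, solTerm a b Q x * levelFactor Q k (x.1 + x.2)

/-- A term of the explicit solution for the partitions whose parts are at least `3k+3`. -/
noncomputable def solThreeTerm (a b Q : ℂ) (k : ℕ) (x : ℕ × ℕ) : ℂ :=
  (solTerm a b Q x + solTerm b a Q x.swap) *
    (Q ^ (x.1 + x.2) / (1 + Q ^ (x.1 + x.2)) * levelFactor Q k (x.1 + x.2))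

/-- The explicit solution for the partitions whose parts are at least `3k+3`. -/
noncomputable def solThree (a b Q : ℂ) (k : ℕ) : ℂ := ∑' x : ℕ × ℕ, solThreeTerm a b Q k x

theorem summable_norm_solTerm (a b : ℂ) {Q : ℂ} (hQ : ‖Q‖ < 1) :
    Summable (fun x => ‖solTerm a b Q x‖) := by
  refine ((summable_norm_eulerTerm a hQ).mul_of_nonneg (summable_norm_eulerTerm (b / Q) hQ)
    (fun _ => norm_nonneg _) (fun _ => norm_nonneg _)).congr fun x => ?_
  rw [solTerm, norm_mul]

theorem summable_norm_solTerm_swap (a b : ℂ) {Q : ℂ} (hQ : ‖Q‖ < 1) :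
    Summable (fun x : ℕ × ℕ => ‖solTerm b a Q x.swap‖) :=
  (Equiv.prodComm ℕ ℕ).summable_iff.mpr (summable_norm_solTerm b a hQ)

theorem norm_pow_div_le {Q : ℂ} (hQ : ‖Q‖ < 1) (n : ℕ) :
    ‖Q ^ n / (1 + Q ^ n)‖ ≤ 1 / (1 - ‖Q‖) := by
  have h0 : 0 < 1 - ‖Q‖ := by linarith
  have h1 : 1 - ‖Q‖ ≤ ‖1 + Q ^ n‖ := by
    rcases n with _ | n
    · norm_num
      linarith [norm_nonneg Q]
    · have h2 := norm_sub_norm_le (1 : ℂ) (-Q ^ (n + 1))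
      rw [norm_one, norm_neg, norm_pow, sub_neg_eq_add] at h2
      have h3 : ‖Q‖ ^ (n + 1) ≤ ‖Q‖ := by
        simpa using pow_le_pow_of_le_one (norm_nonneg Q) hQ.le (Nat.succ_le_succ n.zero_le)
      linarith
  rw [norm_div, norm_pow]
  gcongr
  exact pow_le_one₀ (norm_nonneg Q) hQ.le

theorem exists_bound_solTwo (a b : ℂ) {Q : ℂ} (hQ : ‖Q‖ < 1) :
    ∃ B : ℕ × ℕ → ℝ, Summable B ∧
      ∀ k x, ‖solTerm a b Q x * levelFactor Q k (x.1 + x.2)‖ ≤ B x := by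
  obtain ⟨K, hK⟩ := exists_norm_levelFactor_le hQ
  refine ⟨_, (summable_norm_solTerm a b hQ).mul_right K, fun k x => ?_⟩
  rw [norm_mul]
  exact mul_le_mul_of_nonneg_left (hK k _) (norm_nonneg _)

theorem exists_bound_solThree (a b : ℂ) {Q : ℂ} (hQ : ‖Q‖ < 1) :
    ∃ B : ℕ × ℕ → ℝ, Summable B ∧ ∀ k x, ‖solThreeTerm a b Q k x‖ ≤ B x := by
  obtain ⟨K, hK⟩ := exists_norm_levelFactor_le hQ
  have hK0 : 0 ≤ K := (norm_nonneg _).trans (hK 0 0)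
  have h0 : 0 < 1 - ‖Q‖ := by linarith
  refine ⟨_, ((summable_norm_solTerm a b hQ).add (summable_norm_solTerm_swap a b hQ)).mul_right
    (1 / (1 - ‖Q‖) * K), fun k x => ?_⟩
  rw [solThreeTerm, norm_mul, norm_mul]
  gcongr
  · exact norm_add_le _ _
  · exact norm_pow_div_le hQ _
  · exact hK _ _

theorem hasSum_solTwo (a b : ℂ) {Q : ℂ} (hQ : ‖Q‖ < 1) (k : ℕ) :
    HasSum (fun x : ℕ × ℕ => solTerm a b Q x * levelFactor Q k (x.1 + x.2)) (solTwo a b Q k) := by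
  obtain ⟨B, hB, h⟩ := exists_bound_solTwo a b hQ
  exact (hB.of_norm_bounded (h k)).hasSum

theorem hasSum_solTwo_swap (a b : ℂ) {Q : ℂ} (hQ : ‖Q‖ < 1) (k : ℕ) :
    HasSum (fun x : ℕ × ℕ => solTerm b a Q x.swap * levelFactor Q k (x.1 + x.2))
      (solTwo b a Q k) := by
  refine ((Equiv.prodComm ℕ ℕ).hasSum_iff.mpr (hasSum_solTwo b a hQ k)).congr_fun fun x => ?_
  simp [add_comm]

theorem hasSum_solThree (a b : ℂ) {Q : ℂ} (hQ : ‖Q‖ < 1) (k : ℕ) :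
    HasSum (solThreeTerm a b Q k) (solThree a b Q k) := by
  obtain ⟨B, hB, h⟩ := exists_bound_solThree a b hQ
  exact (hB.of_norm_bounded (h k)).hasSum

theorem solThree_swap (a b Q : ℂ) (k : ℕ) : solThree b a Q k = solThree a b Q k := by
  rw [solThree, ← (Equiv.prodComm ℕ ℕ).tsum_eq, solThree]
  refine tsum_congr fun x => ?_
  simp only [solThreeTerm, Equiv.prodComm_apply, Prod.swap_swap, Prod.fst_swap, Prod.snd_swap]
  rw [add_comm x.2 x.1, add_comm (solTerm b a Q x.swap)]

theorem solTerm_zero (a b Q : ℂ) : solTerm a b Q (0, 0) = 1 := by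
  simp [solTerm, eulerTerm, qFactorial_zero]

theorem tendsto_solTwo (a b : ℂ) {Q : ℂ} (hQ : ‖Q‖ < 1) :
    Tendsto (solTwo a b Q) atTop (𝓝 1) := by
  obtain ⟨B, hB, h⟩ := exists_bound_solTwo a b hQ
  have h1 := tendsto_tsum_of_dominated_convergence hB
    (fun x => (tendsto_levelFactor hQ (x.1 + x.2)).const_mul (solTerm a b Q x))
    (Eventually.of_forall h)
  rw [tsum_eq_single (0, 0) (by rintro ⟨i, j⟩ hij; simp at hij ⊢; tauto)] at h1
  simp only [solTerm_zero, add_zero, if_true, mul_one] at h1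
  exact h1

theorem tendsto_solThree (a b : ℂ) {Q : ℂ} (hQ : ‖Q‖ < 1) :
    Tendsto (solThree a b Q) atTop (𝓝 1) := by
  obtain ⟨B, hB, h⟩ := exists_bound_solThree a b hQ
  have h1 := tendsto_tsum_of_dominated_convergence hB
    (fun x => ((tendsto_levelFactor hQ (x.1 + x.2)).const_mul
      (Q ^ (x.1 + x.2) / (1 + Q ^ (x.1 + x.2)))).const_mul (solTerm a b Q x + solTerm b a Q x.swap))
    (Eventually.of_forall h)
  rw [tsum_eq_single (0, 0) (by rintro ⟨i, j⟩ hij; simp at hij ⊢; tauto)] at h1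
  have h2 : ((1 : ℂ) + 1) * (1 / (1 + 1)) = 1 := by norm_num
  simp only [solTerm_zero, Prod.swap, add_zero, pow_zero, if_true, mul_one, h2] at h1
  exact h1

theorem hasSum_of_shift_snd {d s f : ℕ × ℕ → ℂ} {S F : ℂ} (hs : HasSum s S) (hf : HasSum f F)
    (h0 : ∀ i, d (i, 0) = s (i, 0)) (h1 : ∀ i j, d (i, j + 1) = s (i, j + 1) + f (i, j)) :
    HasSum d (S + F) := by
  have hinj : Function.Injective (fun x : ℕ × ℕ => (x.1, x.2 + 1)) := by
    rintro ⟨i, j⟩ ⟨k, l⟩ h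
    simpa using h
  have h2 : HasSum (fun x => d x - s x) F := by
    refine (hinj.hasSum_iff ?_).mp ?_
    · rintro ⟨i, j⟩ hx
      rcases j with _ | j
      · rw [h0, sub_self]
      · exact absurd ⟨(i, j), rfl⟩ hx
    · simpa [Function.comp_def, h1] using hf
  simpa using hs.add h2

theorem eulerTerm_div (z : ℂ) (Q : ℂ) (i : ℕ) :
    eulerTerm (z / Q) Q i = eulerTerm z Q i / Q ^ i := by
  rw [eulerTerm, eulerTerm, div_pow]
  ring

theorem eulerTerm_succ (z : ℂ) {Q : ℂ} (hQ : ‖Q‖ < 1) (i : ℕ) :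
    eulerTerm z Q (i + 1) * (1 - (Q ^ 2) ^ (i + 1)) = z * Q ^ (2 * i + 1) * eulerTerm z Q i := by
  have h1 := one_sub_pow_ne_zero (norm_sq_lt_one hQ) i
  have h2 := qFactorial_ne_zero (norm_sq_lt_one hQ) i
  rw [eulerTerm, eulerTerm, qFactorial_succ]
  field_simp
  ring

theorem solTwo_eq (a b : ℂ) {Q : ℂ} (hQ0 : Q ≠ 0) (hQ : ‖Q‖ < 1) (k : ℕ) :
    solTwo a b Q k = solThree a b Q k + b * Q ^ k * solTwo b a Q (k + 1) := by
  refine (hasSum_solTwo a b hQ k).unique (hasSum_of_shift_snd (hasSum_solThree a b hQ k)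
    ((hasSum_solTwo_swap a b hQ (k + 1)).mul_left (b * Q ^ k)) (fun i => ?_) (fun i j => ?_))
  · have h1 := one_add_pow_ne_zero hQ i
    have h2 : eulerTerm b Q 0 = 1 := by simp [eulerTerm, qFactorial_zero]
    simp only [solThreeTerm, solTerm, Prod.swap, eulerTerm_div, add_zero, pow_zero, h2]
    field_simp
    ring
  · have h1 := one_add_pow_ne_zero hQ (i + j + 1)
    have h2 := one_sub_pow_ne_zero (norm_sq_lt_one hQ) j
    have h3 := levelFactor_succ_right Q k (i + j)
    have h4 := eulerTerm_succ b hQ j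
    have h5 : levelFactor Q (k + 1) (i + j) =
        levelFactor Q k (i + j + 1) * Q ^ (i + j) / ((1 + Q ^ (i + j + 1)) * Q ^ k) := by
      field_simp
      rw [h3]
      ring
    have h6 : eulerTerm b Q j * b =
        eulerTerm b Q (j + 1) * (1 - (Q ^ 2) ^ (j + 1)) / Q ^ (2 * j + 1) := by
      field_simp
      rw [h4]
      ring
    simp only [solThreeTerm, solTerm, Prod.swap, eulerTerm_div, ← add_assoc, h5]
    rw [show b * Q ^ k * (eulerTerm b Q j * (eulerTerm a Q i / Q ^ i) *
      (levelFactor Q k (i + j + 1) * Q ^ (i + j) / ((1 + Q ^ (i + j + 1)) * Q ^ k))) =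
      (eulerTerm b Q j * b) * (Q ^ k * ((eulerTerm a Q i / Q ^ i) *
      (levelFactor Q k (i + j + 1) * Q ^ (i + j) / ((1 + Q ^ (i + j + 1)) * Q ^ k)))) by ring, h6]
    field_simp
    ring

theorem solThree_eq (a b : ℂ) {Q : ℂ} (hQ : ‖Q‖ < 1) (k : ℕ) :
    solThree a b Q k = solTwo a b Q (k + 1) + solTwo b a Q (k + 1) -
      (1 - Q ^ (k + 1)) * solThree a b Q (k + 1) := by
  refine (hasSum_solThree a b hQ k).unique ((((hasSum_solTwo a b hQ (k + 1)).add
    (hasSum_solTwo_swap a b hQ (k + 1))).sub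
      ((hasSum_solThree a b hQ (k + 1)).mul_left (1 - Q ^ (k + 1)))).congr_fun fun x => ?_)
  have h1 := one_add_pow_ne_zero hQ (x.1 + x.2)
  have h2 := levelFactor_succ_left hQ k (x.1 + x.2)
  simp only [solThreeTerm]
  rw [div_mul_eq_mul_div, h2]
  field_simp
  ring

/-- A nonnegative null sequence that grows backwards at most by factors with convergent product
vanishes. -/
theorem eq_zero_of_le_mul {m c : ℕ → ℝ} (hm : ∀ k, 0 ≤ m k) (hc : ∀ k, 0 ≤ c k)
    (hcs : Summable c) (h : ∀ k, m k ≤ (1 + c k) * m (k + 1)) (hlim : Tendsto m atTop (𝓝 0))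
    (k : ℕ) : m k = 0 := by
  have h1 : ∀ n, m k ≤ Real.exp (∑' l, c l) * m (k + n) := by
    intro n
    have h2 : m k ≤ (∏ l ∈ Finset.range n, (1 + c (k + l))) * m (k + n) := by
      induction n with
      | zero => simp
      | succ n ih =>
        rw [Finset.prod_range_succ, mul_assoc]
        exact ih.trans (mul_le_mul_of_nonneg_left (h (k + n))
          (Finset.prod_nonneg fun l _ => add_nonneg zero_le_one (hc _)))
    refine h2.trans (mul_le_mul_of_nonneg_right ?_ (hm _))
    refine (Real.prod_one_add_le_exp_sum _ (fun l => hc (k + l))).trans (Real.exp_le_exp.mpr ?_)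
    have h3 : Summable (fun l => c (k + l)) := by
      simpa [add_comm] using (summable_nat_add_iff k).mpr hcs
    refine (h3.sum_le_tsum _ fun l _ => hc _).trans ?_
    exact tsum_comp_le_tsum_of_inj hcs hc (add_right_injective k)
  have h4 : Tendsto (fun n => Real.exp (∑' l, c l) * m (k + n)) atTop (𝓝 0) := by
    simpa [add_comm] using ((tendsto_add_atTop_iff_nat k).mpr hlim).const_mul (Real.exp (∑' l, c l))
  exact le_antisymm (ge_of_tendsto' h4 h1) (hm k)

/-- The recurrence determines its solutions from their limits: a solution that tends to zero
vanishes. -/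
theorem recurrence_eq_zero {a b Q : ℂ} (hQ : ‖Q‖ < 1) {A D E : ℕ → ℂ}
    (hD : ∀ k, D k = A k + b * Q ^ k * E (k + 1)) (hE : ∀ k, E k = A k + a * Q ^ k * D (k + 1))
    (hA : ∀ k, A k = D (k + 1) + E (k + 1) - (1 - Q ^ (k + 1)) * A (k + 1))
    (hA0 : Tendsto A atTop (𝓝 0)) (hD0 : Tendsto D atTop (𝓝 0)) (hE0 : Tendsto E atTop (𝓝 0)) :
    A 0 = 0 ∧ D 0 = 0 ∧ E 0 = 0 := by
  set m : ℕ → ℝ := fun k => max ‖A k‖ (max ‖D (k + 1)‖ ‖E (k + 1)‖) with hm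
  have hmA : ∀ k, ‖A k‖ ≤ m k := fun k => le_max_left _ _
  have hmD : ∀ k, ‖D (k + 1)‖ ≤ m k := fun k => (le_max_left _ _).trans (le_max_right _ _)
  have hmE : ∀ k, ‖E (k + 1)‖ ≤ m k := fun k => (le_max_right _ _).trans (le_max_right _ _)
  have hm0 : ∀ k, 0 ≤ m k := fun k => (norm_nonneg _).trans (hmA k)
  have hlim : Tendsto m atTop (𝓝 0) := by
    have h1 := hA0.norm.max (((tendsto_add_atTop_iff_nat 1).mpr hD0).norm.max
      ((tendsto_add_atTop_iff_nat 1).mpr hE0).norm)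
    simpa [hm] using h1
  have hc : Summable (fun k : ℕ => (1 + ‖a‖ + ‖b‖) * ‖Q‖ ^ (k + 1)) :=
    ((summable_nat_add_iff 1).mpr (summable_geometric_of_lt_one (norm_nonneg Q) hQ)).mul_left _
  have hm' : ∀ k, m k = 0 := by
    refine eq_zero_of_le_mul hm0 (fun k => by positivity) hc (fun k => ?_) hlim
    have hb : ‖b * Q ^ (k + 1) * E (k + 1 + 1)‖ ≤ ‖b‖ * ‖Q‖ ^ (k + 1) * m (k + 1) := by
      rw [norm_mul, norm_mul, norm_pow]
      exact mul_le_mul_of_nonneg_left (hmE _) (by positivity)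
    have ha : ‖a * Q ^ (k + 1) * D (k + 1 + 1)‖ ≤ ‖a‖ * ‖Q‖ ^ (k + 1) * m (k + 1) := by
      rw [norm_mul, norm_mul, norm_pow]
      exact mul_le_mul_of_nonneg_left (hmD _) (by positivity)
    have h1 : ‖Q ^ (k + 1) * A (k + 1)‖ ≤ ‖Q‖ ^ (k + 1) * m (k + 1) := by
      rw [norm_mul, norm_pow]
      exact mul_le_mul_of_nonneg_left (hmA _) (by positivity)
    have h2 := hmA (k + 1)
    have h3 : 0 ≤ ‖a‖ * ‖Q‖ ^ (k + 1) * m (k + 1) :=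
      mul_nonneg (by positivity) (hm0 _)
    have h4 : 0 ≤ ‖b‖ * ‖Q‖ ^ (k + 1) * m (k + 1) :=
      mul_nonneg (by positivity) (hm0 _)
    have h5 : 0 ≤ ‖Q‖ ^ (k + 1) * m (k + 1) := mul_nonneg (by positivity) (hm0 _)
    refine max_le ?_ (max_le ?_ ?_)
    · have h6 : A k = A (k + 1) + Q ^ (k + 1) * A (k + 1) + b * Q ^ (k + 1) * E (k + 1 + 1) +
          a * Q ^ (k + 1) * D (k + 1 + 1) := by
        rw [hA k, hD (k + 1), hE (k + 1)]
        ring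
      rw [h6]
      refine (norm_add_le _ _).trans ?_
      have h7 := norm_add₃_le (a := A (k + 1)) (b := Q ^ (k + 1) * A (k + 1))
        (c := b * Q ^ (k + 1) * E (k + 1 + 1))
      linarith
    · rw [hD (k + 1)]
      refine (norm_add_le _ _).trans ?_
      linarith
    · rw [hE (k + 1)]
      refine (norm_add_le _ _).trans ?_
      linarith
  have hA' : ∀ k, A k = 0 := fun k => norm_le_zero_iff.mp ((hmA k).trans (hm' k).le)
  have hD' : ∀ k, D (k + 1) = 0 := fun k => norm_le_zero_iff.mp ((hmD k).trans (hm' k).le)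
  have hE' : ∀ k, E (k + 1) = 0 := fun k => norm_le_zero_iff.mp ((hmE k).trans (hm' k).le)
  refine ⟨hA' 0, ?_, ?_⟩
  · rw [hD, hA', hE', mul_zero, add_zero]
  · rw [hE, hA', hD', mul_zero, add_zero]

/-- The generating functions agree with the explicit solution, at `a = tq`, `b = t⁻¹q²`, `Q = q³`. -/
theorem C_eq_sol {t q : ℂ} (ht : t ≠ 0) (hq0 : q ≠ 0) (hq : ‖q‖ < 1) :
    C 3 t q = solThree (t * q) (t⁻¹ * q ^ 2) (q ^ 3) 0 ∧
    C 2 t q = solTwo (t * q) (t⁻¹ * q ^ 2) (q ^ 3) 0 ∧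
    C2star t q = solTwo (t⁻¹ * q ^ 2) (t * q) (q ^ 3) 0 := by
  have hQ : ‖q ^ 3‖ < 1 := by
    rw [norm_pow]
    exact pow_lt_one₀ (norm_nonneg q) hq three_ne_zero
  have hQ0 : q ^ 3 ≠ 0 := pow_ne_zero 3 hq0
  set a := t * q with ha
  set b := t⁻¹ * q ^ 2 with hb
  set G : ℕ → ℂ := fun m => genFun t q (GapSetFrom m) with hG
  have hlim : ∀ c, Tendsto (fun k : ℕ => G (3 * k + c)) atTop (𝓝 1) := fun c =>
    (tendsto_genFun t hq).comp (tendsto_atTop_mono (fun k => by simp only [id]; omega) tendsto_id)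
  have h0 : ∀ k, G (3 * k + 3) = G (3 * k + 4) + (q ^ 3) ^ (k + 1) * G (3 * k + 6) := fun k => by
    simpa [hG, mul_add, ← pow_mul, add_assoc] using genFun_zero_mod t hq (k + 1)
  have h1 : ∀ k, G (3 * k + 1) = G (3 * k + 2) + a * (q ^ 3) ^ k * G (3 * k + 5) := fun k => by
    simp only [hG, ha]
    rw [genFun_one_mod t hq k]
    ring
  have h2 : ∀ k, G (3 * k + 2) = G (3 * k + 3) + b * (q ^ 3) ^ k * (G (3 * k + 6) +
      a * (q ^ 3) ^ (k + 1) * G (3 * k + 8)) := fun k => by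
    simp only [hG, ha, hb]
    rw [genFun_two_mod t hq k]
    ring
  have h1' : ∀ k, G (3 * k + 4) = G (3 * k + 5) + a * (q ^ 3) ^ (k + 1) * G (3 * k + 8) :=
    fun k => h1 (k + 1)
  have key := recurrence_eq_zero (a := a) (b := b) hQ
    (A := fun k => G (3 * k + 3) - solThree a b (q ^ 3) k)
    (D := fun k => G (3 * k + 2) - solTwo a b (q ^ 3) k)
    (E := fun k => G (3 * k + 1) - G (3 * k + 2) + G (3 * k + 3) - solTwo b a (q ^ 3) k)
    (fun k => ?_) (fun k => ?_) (fun k => ?_) ?_ ?_ ?_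
  · obtain ⟨k1, k2, k3⟩ := key
    simp only [mul_zero, zero_add, hG, ← C_eq_genFun ht le_rfl, ← C_eq_genFun ht one_le_two,
      ← C_eq_genFun ht (show 1 ≤ 3 by norm_num)] at k1 k2 k3
    exact ⟨sub_eq_zero.mp k1, sub_eq_zero.mp k2, sub_eq_zero.mp k3⟩
  · simp only [mul_add, mul_one, add_assoc, Nat.reduceAdd]
    rw [solTwo_eq a b hQ0 hQ k]
    linear_combination h2 k - b * (q ^ 3) ^ k * h1' k
  · simp only [mul_add, mul_one, add_assoc, Nat.reduceAdd]
    rw [solTwo_eq b a hQ0 hQ k, solThree_swap]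
    linear_combination h1 k
  · simp only [mul_add, mul_one, add_assoc, Nat.reduceAdd]
    rw [solThree_eq a b hQ k]
    linear_combination h0 k
  · simpa using (hlim 3).sub (tendsto_solThree a b hQ)
  · simpa using (hlim 2).sub (tendsto_solTwo a b hQ)
  · simpa using (((hlim 1).sub (hlim 2)).add (hlim 3)).sub (tendsto_solTwo b a hQ)

end Capparelli

/-! ### The coefficients of the explicit solution -/

namespace Capparelli

open Filter Topology

/-- At `ab = Q` the two infinite products of Euler series combine to a Jacobi theta series. -/
theorem solTwo_zero {a b Q : ℂ} (ha : a ≠ 0) (hQ0 : Q ≠ 0) (hQ : ‖Q‖ < 1) (hab : a * b = Q) :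
    HasSum (fun n : ℤ => qPochInf (-Q) Q * (a ^ n * Q ^ (n * n)))
      (qPochInf (Q ^ 2) (Q ^ 2) * solTwo a b Q 0) := by
  have h1 : b / Q = a⁻¹ := by
    rw [← hab]
    have hb : b ≠ 0 := by
      rintro rfl
      exact hQ0 (by rw [← hab, mul_zero])
    field_simp
  have h2 : solTwo a b Q 0 =
      (qPochInf (-(a * Q)) (Q ^ 2) * qPochInf (-(a⁻¹ * Q)) (Q ^ 2)) * qPochInf (-Q) Q := by
    refine (hasSum_solTwo a b hQ 0).unique ?_
    refine ((hasSum_eulerTerm_mul_eulerTerm a a⁻¹ hQ).mul_right _).congr_fun fun x => ?_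
    rw [levelFactor_zero hQ, solTerm, h1]
  have h3 := (hasSum_jacobi ha hQ0 hQ).mul_left (qPochInf (-Q) Q)
  rw [h2, ← mul_assoc, mul_comm _ (qPochInf (-Q) Q)]
  exact h3

/-- The `j`-th term of the series for the coefficients of `solThree`, in the variable `y = Q^n`. The
denominators `1 + y p^j` do not vanish for these `y`. -/
noncomputable def coeffTerm (y p : ℂ) (j : ℕ) : ℂ :=
  (1 + y) * p ^ j / (1 + y * p ^ j) * cauchyTerm (y ^ 2) p j

theorem exists_norm_coeffTerm_le (y : ℂ) {p : ℂ} (hp : ‖p‖ < 1) :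
    ∃ K : ℝ, ∀ n j : ℕ, ‖coeffTerm (y * p ^ n) p j‖ ≤ (‖y‖ ^ 2) ^ j * ‖p‖ ^ (j * j) * K := by
  obtain ⟨K, hK⟩ := exists_norm_cauchyTerm_le hp (‖y‖ ^ 2)
  have h1 : Tendsto (fun j : ℕ => (1 + y * p ^ j)⁻¹) atTop (𝓝 1) := by
    have := ((tendsto_pow_mul_zero y hp).const_add 1).inv₀ (by norm_num)
    simpa using this
  obtain ⟨L, hL⟩ := (Metric.isBounded_range_of_tendsto _ h1).exists_norm_le
  refine ⟨(1 + ‖y‖) * 1 * L * K, fun n j => ?_⟩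
  have h2 : ‖(1 + y * p ^ n * p ^ j)⁻¹‖ ≤ L := by
    rw [mul_assoc, ← pow_add]
    exact hL _ (Set.mem_range_self (n + j))
  have h3 : ‖1 + y * p ^ n‖ ≤ 1 + ‖y‖ := by
    refine (norm_add_le _ _).trans ?_
    rw [norm_one]
    have := norm_mul_pow_le y hp n
    gcongr
  have h4 : ‖p ^ j‖ ≤ 1 := by
    rw [norm_pow]
    exact pow_le_one₀ (norm_nonneg p) hp.le
  have h5 : ‖cauchyTerm ((y * p ^ n) ^ 2) p j‖ ≤ (‖y‖ ^ 2) ^ j * ‖p‖ ^ (j * j) * K := by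
    refine hK _ ?_ j
    rw [norm_pow]
    exact pow_le_pow_left₀ (norm_nonneg _) (norm_mul_pow_le y hp n) 2
  have h6 : ‖(1 + y * p ^ n) * p ^ j / (1 + y * p ^ n * p ^ j)‖ ≤ (1 + ‖y‖) * 1 * L := by
    refine norm_mul_inv_le ?_ h2
    rw [norm_mul]
    exact mul_le_mul h3 h4 (norm_nonneg _) (by positivity)
  rw [coeffTerm, norm_mul]
  refine (mul_le_mul h6 h5 (norm_nonneg _) ((norm_nonneg _).trans h6)).trans_eq ?_
  ring

theorem summable_coeffTerm (y : ℂ) {p : ℂ} (hp : ‖p‖ < 1) :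
    Summable (coeffTerm y p) := by
  obtain ⟨K, hK⟩ := exists_norm_coeffTerm_le y hp
  have h1 := (summable_pow_mul_pow_sq (sq_nonneg ‖y‖) (norm_nonneg p) hp).mul_right K
  refine h1.of_norm_bounded fun j => ?_
  simpa using hK 0 j

theorem tendsto_tsum_coeffTerm (y : ℂ) {p : ℂ} (hp : ‖p‖ < 1) :
    Tendsto (fun n : ℕ => ∑' j, coeffTerm (y * p ^ n) p j) atTop (𝓝 1) := by
  obtain ⟨K, hK⟩ := exists_norm_coeffTerm_le y hp
  rw [show (1 : ℂ) = ∑' j : ℕ, if j = 0 then 1 else 0 by simp]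
  refine tendsto_tsum_of_dominated_convergence ((summable_pow_mul_pow_sq (sq_nonneg ‖y‖)
    (norm_nonneg p) hp).mul_right K) (fun j => ?_) (Eventually.of_forall hK)
  have h1 := tendsto_pow_mul_zero y hp
  have h2 := tendsto_cauchyTerm hp (u := fun n => (y * p ^ n) ^ 2) (by simpa using h1.pow 2) j
  have h3 := (((h1.const_add 1).mul_const (p ^ j)).div ((h1.mul_const (p ^ j)).const_add 1)
    (by simp)).mul h2
  have h4 : (1 + 0) * p ^ j / (1 + 0 * p ^ j) * (if j = 0 then 1 else 0) =
      if j = 0 then 1 else 0 := by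
    rcases j with _ | j <;> simp
  rw [← h4]
  exact h3

/-- The functional equation of the coefficient series. Subtracting the shifted series term by term
cancels the denominators `1 + y p^j` and leaves Cauchy's series. -/
theorem tsum_coeffTerm {y p : ℂ} (hp : ‖p‖ < 1) (hy : ∀ j : ℕ, 1 + y * p ^ j ≠ 0) :
    ∑' j, coeffTerm y p j =
      1 - y ^ 2 * p + y ^ 3 * p ^ 2 * ∑' j, coeffTerm (y * p) p j := by
  have hy' : ∀ j : ℕ, 1 + y * p * p ^ j ≠ 0 := fun j => by
    rw [mul_assoc, ← pow_succ']
    exact hy (j + 1)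
  have h1 := summable_coeffTerm y hp
  have h2 := summable_coeffTerm (y * p) hp
  have h3 := hasSum_cauchyTerm (y ^ 2 * p) hp
  have h4 : ∀ j, coeffTerm y p (j + 1) = (1 - y ^ 2 * p) * cauchyTerm (y ^ 2 * p) p (j + 1) +
      y ^ 3 * p ^ 2 * coeffTerm (y * p) p j := by
    intro j
    have h5 := qFactorial_ne_zero hp j
    have h6 := one_sub_pow_ne_zero hp j
    have h7 := hy (j + 1)
    have h8 := hy' j
    simp only [coeffTerm, cauchyTerm]
    rw [qFactorial_succ, qPochInf_eq_mul (y ^ 2 * p ^ (j + 1 + 1)) hp,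
      show y ^ 2 * p ^ (j + 1 + 1) * p = y ^ 2 * p ^ (j + 3) by ring,
      show y ^ 2 * p * p ^ (j + 1 + 1) = y ^ 2 * p ^ (j + 3) by ring,
      show (y * p) ^ 2 * p ^ (j + 1) = y ^ 2 * p ^ (j + 3) by ring,
      show y * p * p ^ j = y * p ^ (j + 1) by ring]
    field_simp
    ring
  have h0 : coeffTerm y p 0 = (1 - y ^ 2 * p) * cauchyTerm (y ^ 2 * p) p 0 := by
    have h7 := hy 0
    simp only [pow_zero, mul_one] at h7
    simp only [coeffTerm, cauchyTerm, pow_zero, mul_one, one_mul, zero_add, pow_one,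
      qFactorial_zero, mul_zero, div_one, div_self h7]
    rw [qPochInf_eq_mul _ hp]
  rw [h1.tsum_eq_zero_add, h0]
  simp only [h4]
  rw [Summable.tsum_add (((summable_nat_add_iff 1).mpr h3.summable).mul_left _) (h2.mul_left _),
    tsum_mul_left, tsum_mul_left, ← add_assoc, ← mul_add, ← h3.summable.tsum_eq_zero_add,
    h3.tsum_eq, mul_one]

theorem summable_falseTheta (y : ℂ) {Q : ℂ} (hQ : ‖Q‖ < 1) :
    Summable (fun i : ℕ => (y ^ 3 * Q) ^ i * (Q ^ 3) ^ (i * i) * (1 - y ^ 2 * Q ^ (4 * i + 2))) := by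
  have hQ3 : ‖Q ^ 3‖ < 1 := by
    rw [norm_pow]
    exact pow_lt_one₀ (norm_nonneg Q) hQ three_ne_zero
  have h1 : ∀ c : ℂ, Summable (fun i : ℕ => c ^ i * (Q ^ 3) ^ (i * i)) := fun c => by
    refine (summable_pow_mul_pow_sq (norm_nonneg c) (norm_nonneg _) hQ3).of_norm_bounded fun i => ?_
    rw [norm_mul, norm_pow, norm_pow]
  refine ((h1 (y ^ 3 * Q)).sub ((h1 (y ^ 3 * Q ^ 5)).mul_left (y ^ 2 * Q ^ 2))).congr fun i => ?_
  ring

/-- Iterating the functional equation expresses the coefficient series as a false theta series. -/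
theorem hasSum_falseTheta {y Q : ℂ} (hQ : ‖Q‖ < 1) (hy : ∀ j : ℕ, 1 + y * (Q ^ 2) ^ j ≠ 0) :
    HasSum (fun i : ℕ => (y ^ 3 * Q) ^ i * (Q ^ 3) ^ (i * i) * (1 - y ^ 2 * Q ^ (4 * i + 2)))
      (∑' j, coeffTerm y (Q ^ 2) j) := by
  have hp := norm_sq_lt_one hQ
  have hs := summable_falseTheta y hQ
  have hs' : Summable (fun i : ℕ => (y ^ 3 * Q) ^ i * (Q ^ 3) ^ (i * i)) := by
    have hQ3 : ‖Q ^ 3‖ < 1 := by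
      rw [norm_pow]
      exact pow_lt_one₀ (norm_nonneg Q) hQ three_ne_zero
    refine (summable_pow_mul_pow_sq (norm_nonneg (y ^ 3 * Q)) (norm_nonneg _)
      hQ3).of_norm_bounded fun i => ?_
    rw [norm_mul, norm_pow, norm_pow]
  have h1 : ∀ n : ℕ, ∑' j, coeffTerm y (Q ^ 2) j =
      (∑ i ∈ Finset.range n, (y ^ 3 * Q) ^ i * (Q ^ 3) ^ (i * i) * (1 - y ^ 2 * Q ^ (4 * i + 2))) +
      (y ^ 3 * Q) ^ n * (Q ^ 3) ^ (n * n) * ∑' j, coeffTerm (y * (Q ^ 2) ^ n) (Q ^ 2) j := by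
    intro n
    induction n with
    | zero => simp
    | succ n ih =>
      rw [ih, Finset.sum_range_succ, tsum_coeffTerm hp (y := y * (Q ^ 2) ^ n) (fun j => by
        rw [mul_assoc, ← pow_add]
        exact hy _), mul_assoc y, ← pow_succ]
      ring
  rw [hs.hasSum_iff_tendsto_nat]
  have h2 := hs'.tendsto_atTop_zero.mul (tendsto_tsum_coeffTerm y hp)
  rw [zero_mul] at h2
  have h3 := h2.const_sub (∑' j, coeffTerm y (Q ^ 2) j)
  rw [sub_zero] at h3
  refine h3.congr fun n => ?_
  rw [sub_eq_iff_eq_add]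
  exact h1 n

theorem one_add_zpow_ne_zero {Q : ℂ} (hQ0 : Q ≠ 0) (hQ : ‖Q‖ < 1) (n : ℤ) : 1 + Q ^ n ≠ 0 := by
  obtain ⟨k, rfl | rfl⟩ := n.eq_nat_or_neg
  · rw [zpow_natCast]
    exact one_add_pow_ne_zero hQ k
  · intro h
    refine one_add_pow_ne_zero hQ k ?_
    have h1 : Q ^ k ≠ 0 := pow_ne_zero k hQ0
    rw [zpow_neg, zpow_natCast] at h
    field_simp at h
    rw [add_comm, h, mul_zero]

/-- At `ab = Q` the terms with `i - j = n` of the explicit solution add up to a coefficient series at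
`y = Q^n`. -/
theorem solThree_zero {a b Q : ℂ} (ha : a ≠ 0) (hQ0 : Q ≠ 0) (hQ : ‖Q‖ < 1) (hab : a * b = Q) :
    HasSum (fun n : ℤ => qPochInf (-Q) Q *
        (a ^ n * Q ^ (n * n) * ∑' j, coeffTerm (Q ^ n) (Q ^ 2) j))
      (qPochInf (Q ^ 2) (Q ^ 2) * solThree a b Q 0) := by
  have hp := norm_sq_lt_one hQ
  have hp0 : Q ^ 2 ≠ 0 := pow_ne_zero 2 hQ0
  have hy : ∀ (n : ℤ) (j : ℕ), 1 + Q ^ n * (Q ^ 2) ^ j ≠ 0 := fun n j => by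
    rw [← pow_mul, ← zpow_natCast, ← zpow_add₀ hQ0]
    exact one_add_zpow_ne_zero hQ0 hQ _
  refine hasSum_diff (g := fun n j => qPochInf (-Q) Q * (a ^ n * Q ^ (n * n) *
    coeffTerm (Q ^ n) (Q ^ 2) j)) ((hasSum_solThree a b hQ 0).mul_left (qPochInf (Q ^ 2) (Q ^ 2)))
    (fun i j => ?_) (fun n j hnj => ?_) (fun n => ?_)
  · have h1 := eulerTerm_mul_eq_cauchyTerm ha hQ0 hQ i j
    have h2 : (Q ^ ((i : ℤ) - j)) ^ 2 = (Q ^ 2) ^ ((i : ℤ) - j) := by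
      rw [zpow_sub_natCast hQ0, zpow_sub_natCast hp0, div_pow]
      ring
    have h3 : b = Q * a⁻¹ := by
      rw [← hab]
      field_simp
    have h4 : eulerTerm b Q j = Q ^ j * eulerTerm a⁻¹ Q j := by
      rw [eulerTerm, eulerTerm, h3, mul_pow]
      ring
    have h5 := one_add_pow_ne_zero hQ (i + j)
    have h6 : (1 + Q ^ ((i : ℤ) - j)) * (Q ^ 2) ^ j / (1 + Q ^ ((i : ℤ) - j) * (Q ^ 2) ^ j) =
        (Q ^ i + Q ^ j) * Q ^ j / (1 + Q ^ (i + j)) := by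
      rw [zpow_sub_natCast hQ0, show Q ^ i / Q ^ j * (Q ^ 2) ^ j = Q ^ (i + j) by
        rw [pow_add]
        field_simp
        ring]
      field_simp
      ring
    simp only [solThreeTerm, solTerm, Prod.swap, levelFactor_zero hQ, eulerTerm_div, coeffTerm,
      h2, h4, h6]
    calc _ = (a ^ ((i : ℤ) - j) * Q ^ (((i : ℤ) - j) * ((i : ℤ) - j)) *
        cauchyTerm ((Q ^ 2) ^ ((i : ℤ) - j)) (Q ^ 2) j) * (qPochInf (-Q) Q *
        ((Q ^ i + Q ^ j) * Q ^ j / (1 + Q ^ (i + j)))) := by ring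
      _ = _ := by
        rw [h1]
        field_simp
        ring
  · have h2 : (Q ^ n) ^ 2 = (Q ^ 2) ^ n := by
      rw [← zpow_natCast, ← zpow_mul, ← zpow_natCast, ← zpow_mul, mul_comm]
    simp only [coeffTerm, cauchyTerm, h2, qPochInf_zpow_eq_zero hp0 hnj]
    simp
  · exact ((summable_coeffTerm _ hp).hasSum.mul_left _).mul_left _

end Capparelli

/-! ### The product of the two theta series -/

namespace Capparelli

open Filter Topology

/-- `∑_l (q^{36l²+6l-18nl} - q^{36l²+30l+6-18nl-6n})` is, up to a monomial, the coefficient of `t^n`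
in the product of the theta series `∑ t^m q^{3m²-2m}` with the completion of `Θ₂` to a series over
all integers. This is the term of index `l`. -/
noncomputable def pentTerm (q : ℂ) (n l : ℤ) : ℂ :=
  q ^ (36 * l * l + 6 * l - 18 * n * l) - q ^ (36 * l * l + 30 * l + 6 - 18 * n * l - 6 * n)

theorem summable_zpow_quadratic {q : ℂ} (hq0 : q ≠ 0) (hq : ‖q‖ < 1) {α : ℕ} (hα : α ≠ 0)
    (β γ : ℤ) : Summable (fun l : ℤ => q ^ (α * l * l + β * l + γ)) := by
  have h1 : ‖q ^ α‖ < 1 := by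
    rw [norm_pow]
    exact pow_lt_one₀ (norm_nonneg q) hq hα
  refine ((summable_norm_zpow_mul_zpow_sq (c := q ^ β) h1).of_norm.mul_left
    (q ^ γ)).congr fun l => ?_
  rw [← zpow_natCast, ← zpow_mul, ← zpow_mul, ← zpow_add₀ hq0, ← zpow_add₀ hq0]
  congr 1
  ring

theorem summable_pent_fst {q : ℂ} (hq0 : q ≠ 0) (hq : ‖q‖ < 1) (n : ℤ) :
    Summable (fun l : ℤ => q ^ (36 * l * l + 6 * l - 18 * n * l)) := by
  refine (summable_zpow_quadratic hq0 hq (α := 36) (by norm_num) (6 - 18 * n) 0).congr fun l => ?_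
  congr 1
  push_cast
  ring

theorem summable_pent_snd {q : ℂ} (hq0 : q ≠ 0) (hq : ‖q‖ < 1) (n : ℤ) :
    Summable (fun l : ℤ => q ^ (36 * l * l + 30 * l + 6 - 18 * n * l - 6 * n)) := by
  refine (summable_zpow_quadratic hq0 hq (α := 36) (by norm_num) (30 - 18 * n)
    (6 - 6 * n)).congr fun l => ?_
  congr 1
  push_cast
  ring

theorem summable_pentTerm {q : ℂ} (hq0 : q ≠ 0) (hq : ‖q‖ < 1) (n : ℤ) :
    Summable (pentTerm q n) :=
  (summable_pent_fst hq0 hq n).sub (summable_pent_snd hq0 hq n)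

/-- The reflection `l ↦ m - l` exchanges the two halves of the series. -/
theorem tsum_pentTerm_odd {q : ℂ} (hq0 : q ≠ 0) (hq : ‖q‖ < 1) (m : ℤ) :
    ∑' l, pentTerm q (2 * m + 1) l = 0 := by
  simp only [pentTerm]
  rw [(summable_pent_fst hq0 hq _).tsum_sub (summable_pent_snd hq0 hq _), sub_eq_zero,
    ← (Equiv.subLeft m).tsum_eq]
  refine tsum_congr fun l => ?_
  rw [Equiv.subLeft_apply]
  congr 1
  ring

theorem tsum_pentTerm_succ {q : ℂ} (hq0 : q ≠ 0) (m : ℤ) :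
    ∑' l, pentTerm q (2 * m) l = -(q ^ (18 * m + 6) * ∑' l, pentTerm q (2 * (m + 1)) l) := by
  rw [← tsum_mul_left, ← tsum_neg, ← (Equiv.subLeft m).tsum_eq]
  refine tsum_congr fun l => ?_
  rw [Equiv.subLeft_apply, pentTerm, pentTerm, mul_sub (q ^ (18 * m + 6)), ← zpow_add₀ hq0, ← zpow_add₀ hq0, neg_sub]
  congr 2 <;> ring

theorem hasSum_int_even_odd {f : ℤ → ℂ} {s : ℂ} (hf : HasSum f s) :
    HasSum (fun l : ℤ => f (2 * l) + f (-(2 * l + 1))) s := by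
  have h1 : Function.Injective (fun l : ℤ => 2 * l) := fun x y h => by simpa using h
  have h2 : Function.Injective (fun l : ℤ => -(2 * l + 1)) := fun x y h => by simpa using h
  have h3 := (hf.summable.comp_injective h1).hasSum
  have h4 := (hf.summable.comp_injective h2).hasSum
  have h5 : IsCompl (Set.range (fun l : ℤ => 2 * l)) (Set.range (fun l : ℤ => -(2 * l + 1))) := by
    refine ⟨Set.disjoint_left.mpr ?_, codisjoint_iff.mpr (Set.eq_univ_of_forall fun n => ?_)⟩
    · rintro _ ⟨x, rfl⟩ ⟨y, h⟩
      simp only at h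
      omega
    · rcases Int.even_or_odd' n with ⟨k, rfl | rfl⟩
      · exact Or.inl ⟨k, rfl⟩
      · exact Or.inr ⟨-k - 1, by ring⟩
  have h6 := (h1.hasSum_range_iff.mpr h3).add_isCompl h5 (h2.hasSum_range_iff.mpr h4)
  rw [hf.unique h6]
  exact h3.add h4

theorem qPochInf_trisect {x : ℂ} (hx : ‖x‖ < 1) :
    qPochInf (x ^ 3) (x ^ 3) * (qPochInf (x ^ 2) (x ^ 3) * qPochInf x (x ^ 3)) = qPochInf x x := by
  have h3 : ‖x ^ 3‖ < 1 := by
    rw [norm_pow]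
    exact pow_lt_one₀ (norm_nonneg x) hx three_ne_zero
  have h1 := (multipliable_qPochInf (x ^ 3) h3).tendsto_prod_tprod_nat.mul
    ((multipliable_qPochInf (x ^ 2) h3).tendsto_prod_tprod_nat.mul
      (multipliable_qPochInf x h3).tendsto_prod_tprod_nat)
  have h2 := (multipliable_qPochInf x hx).tendsto_prod_tprod_nat.comp
    (tendsto_id.const_mul_atTop' (show 0 < 3 by norm_num))
  refine tendsto_nhds_unique h1 (h2.congr fun n => ?_)
  simp only [Function.comp_apply, id]
  induction n with
  | zero => simp
  | succ n ih =>
    rw [mul_add, mul_one, Finset.prod_range_succ, Finset.prod_range_succ, Finset.prod_range_succ,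
      ih, Finset.prod_range_succ, Finset.prod_range_succ, Finset.prod_range_succ]
    ring

/-- Euler's pentagonal number theorem in base `q^6`. -/
theorem tsum_pentTerm_zero {q : ℂ} (hq0 : q ≠ 0) (hq : ‖q‖ < 1) :
    ∑' l, pentTerm q 0 l = qPochInf (q ^ 6) (q ^ 6) := by
  have h9 : ‖q ^ 9‖ < 1 := by
    rw [norm_pow]
    exact pow_lt_one₀ (norm_nonneg q) hq (by norm_num)
  have h6 : ‖q ^ 6‖ < 1 := by
    rw [norm_pow]
    exact pow_lt_one₀ (norm_nonneg q) hq (by norm_num)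
  have h1 := hasSum_int_even_odd (hasSum_jacobi (z := -q ^ 3) (r := q ^ 9)
    (neg_ne_zero.mpr (pow_ne_zero 3 hq0)) (pow_ne_zero 9 hq0) h9)
  have h2 := qPochInf_trisect h6
  have h3 : -(-q ^ 3 * q ^ 9) = (q ^ 6) ^ 2 := by ring
  have h4 : -((-q ^ 3)⁻¹ * q ^ 9) = q ^ 6 := by
    rw [inv_neg]
    field_simp
  rw [h3, h4, show (q ^ 9) ^ 2 = (q ^ 6) ^ 3 by ring, h2] at h1
  refine (h1.congr_fun fun l => ?_).tsum_eq
  have h5 : ∀ k : ℤ, (-q ^ 3) ^ k * (q ^ 9) ^ (k * k) = (-1) ^ k * q ^ (3 * k + 9 * (k * k)) := by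
    intro k
    rw [← neg_one_mul, mul_zpow, mul_assoc, ← zpow_natCast, ← zpow_natCast, ← zpow_mul, ← zpow_mul,
      ← zpow_add₀ hq0]
    norm_cast
  rw [h5, h5, pentTerm, Even.neg_one_zpow (even_two_mul l),
    Odd.neg_one_zpow (odd_two_mul_add_one l).neg, one_mul, neg_one_mul, ← sub_eq_add_neg]
  congr 2 <;> ring

theorem tsum_pentTerm_even {q : ℂ} (hq0 : q ≠ 0) (hq : ‖q‖ < 1) (m : ℤ) :
    ∑' l, pentTerm q (2 * m) l =
      (-1) ^ m * q ^ (3 * m - 9 * m * m) * qPochInf (q ^ 6) (q ^ 6) := by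
  have hstep : ∀ k : ℤ, (-1 : ℂ) ^ k * q ^ (3 * k - 9 * k * k) =
      -(q ^ (18 * k + 6) * ((-1) ^ (k + 1) * q ^ (3 * (k + 1) - 9 * (k + 1) * (k + 1)))) := by
    intro k
    have h1 : 3 * k - 9 * k * k = 18 * k + 6 + (3 * (k + 1) - 9 * (k + 1) * (k + 1)) := by ring
    rw [h1, zpow_add₀ hq0, zpow_add_one₀ (by norm_num)]
    ring
  induction m using Int.induction_on with
  | zero => simpa using tsum_pentTerm_zero hq0 hq
  | succ k ih =>
    rw [tsum_pentTerm_succ hq0, hstep] at ih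
    have h2 : q ^ (18 * (k : ℤ) + 6) ≠ 0 := zpow_ne_zero _ hq0
    refine mul_left_cancel₀ h2 ?_
    linear_combination -ih
  | pred k ih =>
    rw [tsum_pentTerm_succ hq0, hstep, sub_add_cancel, ih]
    ring

/-- Shearing a product of two absolutely convergent series. -/
theorem hasSum_shear {ι : Type*} {u : ℤ → ℂ} {v : ι → ℂ} (hu : Summable (fun n => ‖u n‖))
    (hv : Summable (fun l => ‖v l‖)) (s : ι → ℤ) :
    HasSum (fun x : ℤ × ι => u (x.1 + s x.2) * v x.2) ((∑' n, u n) * ∑' l, v l) := by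
  let σ : ℤ × ι ≃ ℤ × ι :=
    { toFun := fun x => (x.1 + s x.2, x.2)
      invFun := fun x => (x.1 - s x.2, x.2)
      left_inv := fun x => by simp
      right_inv := fun x => by simp }
  rw [tsum_mul_tsum_of_summable_norm hu hv]
  exact σ.hasSum_iff.mpr (summable_mul_of_summable_norm hu hv).hasSum

/-- The terms `t^{3l} q^{(3l)²}` of `Θ₂`, continued to all integers `l`; they enter with sign `+`. -/
noncomputable def thetaPos (t q : ℂ) (l : ℤ) : ℂ := t ^ (3 * l) * q ^ (9 * l * l)

/-- The terms `t^{3l+1} q^{(3l+1)²}` of `Θ₂`, continued to all integers `l`; they enter with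
sign `-`. -/
noncomputable def thetaNeg (t q : ℂ) (l : ℤ) : ℂ :=
  t ^ (3 * l + 1) * q ^ ((3 * l + 1) * (3 * l + 1))

/-- The terms `t^n q^{3n²-2n}` of the theta series for the partitions without the part `2`. -/
noncomputable def starTerm (t q : ℂ) (n : ℤ) : ℂ := t ^ n * q ^ (3 * n * n - 2 * n)

theorem summable_norm_monomial {t q : ℂ} (ht : t ≠ 0) (hq0 : q ≠ 0) (hq : ‖q‖ < 1) (κ lam : ℤ)
    {α : ℕ} (hα : α ≠ 0) (β γ : ℤ) :
    Summable (fun l : ℤ => ‖t ^ (κ * l + lam) * q ^ (α * l * l + β * l + γ)‖) := by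
  have h1 : ‖q ^ α‖ < 1 := by
    rw [norm_pow]
    exact pow_lt_one₀ (norm_nonneg q) hq hα
  refine ((summable_norm_zpow_mul_zpow_sq (c := t ^ κ * q ^ β) h1).mul_left
    ‖t ^ lam * q ^ γ‖).congr fun l => ?_
  rw [← norm_mul]
  congr 1
  rw [mul_zpow, ← zpow_natCast, ← zpow_mul, ← zpow_mul, ← zpow_mul, zpow_add₀ ht, zpow_add₀ hq0,
    zpow_add₀ hq0]
  ring_nf

theorem summable_norm_thetaPos {t q : ℂ} (ht : t ≠ 0) (hq0 : q ≠ 0) (hq : ‖q‖ < 1) :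
    Summable (fun l => ‖thetaPos t q l‖) := by
  simpa [thetaPos] using summable_norm_monomial ht hq0 hq 3 0 (α := 9) (by norm_num) 0 0

theorem summable_norm_thetaNeg {t q : ℂ} (ht : t ≠ 0) (hq0 : q ≠ 0) (hq : ‖q‖ < 1) :
    Summable (fun l => ‖thetaNeg t q l‖) := by
  refine (summable_norm_monomial ht hq0 hq 3 1 (α := 9) (by norm_num) 6 1).congr fun l => ?_
  rw [thetaNeg]
  congr 3
  push_cast
  ring

theorem summable_norm_starTerm {t q : ℂ} (ht : t ≠ 0) (hq0 : q ≠ 0) (hq : ‖q‖ < 1) :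
    Summable (fun n => ‖starTerm t q n‖) := by
  refine (summable_norm_monomial ht hq0 hq 1 0 (α := 3) (by norm_num) (-2) 0).congr fun l => ?_
  rw [starTerm]
  congr 3
  · ring
  · push_cast
    ring

/-- The product of the theta series for the partitions without the part `2` with the completion of
`Θ₂` is a product of infinite products. -/
theorem tsum_starTerm_mul {t q : ℂ} (ht : t ≠ 0) (hq0 : q ≠ 0) (hq : ‖q‖ < 1) :
    (∑' n, starTerm t q n) * (∑' l, thetaPos t q l - ∑' l, thetaNeg t q l) =
      qPochInf (q ^ 6) (q ^ 6) * theta (-(t ^ 2 * q ^ 2)) (q ^ 6) := by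
  have hE := summable_norm_starTerm ht hq0 hq
  have h1 := (hasSum_shear hE (summable_norm_thetaPos ht hq0 hq) (fun l => -(3 * l))).sub
    (hasSum_shear hE (summable_norm_thetaNeg ht hq0 hq) (fun l => -(3 * l + 1)))
  rw [← mul_sub] at h1
  have h2 : HasSum (fun n : ℤ => starTerm t q n * ∑' l, pentTerm q n l)
      ((∑' n, starTerm t q n) * (∑' l, thetaPos t q l - ∑' l, thetaNeg t q l)) := by
    refine h1.prod_fiberwise fun n => ?_
    refine ((summable_pentTerm hq0 hq n).hasSum.mul_left (starTerm t q n)).congr_fun fun l => ?_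
    simp only [starTerm, thetaPos, thetaNeg, pentTerm]
    have h3 : ∀ x y u v : ℤ, t ^ x * q ^ y * (t ^ u * q ^ v) = t ^ (x + u) * q ^ (y + v) := by
      intro x y u v
      rw [zpow_add₀ ht, zpow_add₀ hq0]
      ring
    rw [h3, h3, mul_sub (t ^ n * _), mul_assoc (t ^ n), mul_assoc (t ^ n), ← zpow_add₀ hq0,
      ← zpow_add₀ hq0]
    congr 3 <;> ring
  have hinj : Function.Injective (fun m : ℤ => 2 * m) := fun x y h => by simpa using h
  have h4 := (hinj.hasSum_iff (fun n hn => by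
    rcases Int.even_or_odd' n with ⟨k, rfl | rfl⟩
    · exact absurd ⟨k, rfl⟩ hn
    · rw [tsum_pentTerm_odd hq0 hq, mul_zero])).mpr h2
  have h3 : ‖q ^ 3‖ < 1 := by
    rw [norm_pow]
    exact pow_lt_one₀ (norm_nonneg q) hq three_ne_zero
  have h5 := (hasSum_jacobi (z := -(t ^ 2 / q)) (r := q ^ 3)
    (neg_ne_zero.mpr (div_ne_zero (pow_ne_zero 2 ht) hq0)) (pow_ne_zero 3 hq0) h3).mul_left
      (qPochInf (q ^ 6) (q ^ 6))
  have h6 : -(-(t ^ 2 / q) * q ^ 3) = -(-(t ^ 2 * q ^ 2)) := by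
    field_simp
  have h7 : -((-(t ^ 2 / q))⁻¹ * q ^ 3) = -((-(t ^ 2 * q ^ 2))⁻¹ * q ^ 6) := by
    rw [inv_neg, inv_neg]
    field_simp
  rw [h6, h7, ← pow_mul] at h5
  rw [theta, mul_comm _ (qPochInf (q ^ 6) (q ^ 6))]
  refine h4.unique (h5.congr_fun fun m => ?_)
  simp only [Function.comp_apply]
  have h8 : (-(t ^ 2 / q)) ^ m * (q ^ 3) ^ (m * m) =
      (-1) ^ m * (t ^ (2 * m) * q ^ (3 * (m * m) - m)) := by
    rw [← neg_one_mul, mul_zpow, div_zpow, zpow_sub₀ hq0, ← zpow_natCast, ← zpow_natCast,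
      ← zpow_mul, ← zpow_mul]
    push_cast
    ring
  rw [tsum_pentTerm_even hq0 hq, h8, starTerm]
  have h9 : 3 * (m * m) - m = 3 * (2 * m) * (2 * m) - 2 * (2 * m) + (3 * m - 9 * m * m) := by ring
  rw [h9, zpow_add₀ hq0]
  ring

end Capparelli

/-! ### The false theta series -/

namespace Capparelli

open Filter Topology

theorem chi3_zero_mod (l : ℕ) : chi3 (3 * l) = 1 := by
  have h : (((3 * l : ℕ) : ℤ) + 1) % (3 : ℕ) = 1 := by
    push_cast
    omega
  rw [chi3, legendreSym.mod, h, legendreSym.at_one]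

theorem chi3_one_mod (l : ℕ) : chi3 (3 * l + 1) = -1 := by
  have h : (((3 * l + 1 : ℕ) : ℤ) + 1) % (3 : ℕ) = 2 := by
    push_cast
    omega
  rw [chi3, legendreSym.mod, h]
  decide

theorem chi3_two_mod (l : ℕ) : chi3 (3 * l + 2) = 0 := by
  have h : (((3 * l + 2 : ℕ) : ℤ) + 1) % (3 : ℕ) = 0 := by
    push_cast
    omega
  rw [chi3, legendreSym.mod, h, legendreSym.at_zero]

theorem norm_chi3_le (k : ℕ) : ‖(chi3 k : ℂ)‖ ≤ 1 := by
  have h : k = 3 * (k / 3) ∨ k = 3 * (k / 3) + 1 ∨ k = 3 * (k / 3) + 2 := by omega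
  rcases h with h | h | h <;> rw [h]
  · simp [chi3_zero_mod]
  · simp [chi3_one_mod]
  · simp [chi3_two_mod]

theorem summable_norm_Theta1Term (t : ℂ) {q : ℂ} (hq : ‖q‖ < 1) :
    Summable (fun k => ‖Theta1Term t q k‖) := by
  refine (summable_pow_mul_pow_sq (norm_nonneg (t⁻¹ * q)) (norm_nonneg q) hq).of_nonneg_of_le
    (fun _ => norm_nonneg _) fun k => ?_
  have h : Theta1Term t q k = chi3 k * ((t⁻¹ * q) ^ k * q ^ (k * k)) := by
    rw [Theta1Term, zpow_neg, zpow_natCast, mul_pow, inv_pow]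
    ring
  rw [h, norm_mul, norm_mul, norm_pow, norm_pow]
  exact mul_le_of_le_one_left (by positivity) (norm_chi3_le k)

theorem summable_norm_Theta2Term (t : ℂ) {q : ℂ} (hq : ‖q‖ < 1) :
    Summable (fun k => ‖Theta2Term t q k‖) := by
  refine (summable_pow_mul_pow_sq (norm_nonneg t) (norm_nonneg q) hq).of_nonneg_of_le
    (fun _ => norm_nonneg _) fun k => ?_
  rw [Theta2Term, mul_assoc, norm_mul, norm_mul, norm_pow, norm_pow, pow_two k]
  exact mul_le_of_le_one_left (by positivity) (norm_chi3_le k)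

theorem tsum_eq_of_three_mul_add_two {f : ℕ → ℂ} (hf : Summable f) (h : ∀ l, f (3 * l + 2) = 0) :
    ∑' k, f k = ∑' l, f (3 * l) + ∑' l, f (3 * l + 1) := by
  rw [Nat.sumByResidueClasses hf 3]
  have h1 : ∀ g : ZMod 3 → ℂ, ∑ j, g j = g 0 + g 1 + g 2 := fun g => Fin.sum_univ_three g
  rw [h1]
  have h2 : (2 : ZMod 3).val = 2 := rfl
  have h3 : (1 : ZMod 3).val = 1 := rfl
  have h4 : (0 : ZMod 3).val = 0 := rfl
  simp only [h2, h3, h4, add_comm _ (3 * _), h, tsum_zero, add_zero]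

theorem Theta1_eq (t : ℂ) {q : ℂ} (hq : ‖q‖ < 1) :
    Theta1 t q = ∑' l, Theta1Term t q (3 * l) + ∑' l, Theta1Term t q (3 * l + 1) :=
  tsum_eq_of_three_mul_add_two (summable_norm_Theta1Term t hq).of_norm fun l => by
    simp [Theta1Term, chi3_two_mod]

/-- Extending `Θ₂` to a series over all integers. -/
theorem Theta2_eq {t q : ℂ} (ht : t ≠ 0) (hq0 : q ≠ 0) (hq : ‖q‖ < 1) :
    Theta2 t q = (∑' l, thetaPos t q l - ∑' l, thetaNeg t q l) -
      (∑' l : ℕ, thetaPos t q (-(l + 1)) - ∑' l : ℕ, thetaNeg t q (-(l + 1))) := by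
  have hp := (summable_norm_thetaPos ht hq0 hq).of_norm
  have hn := (summable_norm_thetaNeg ht hq0 hq).of_norm
  have hi : Function.Injective (fun l : ℕ => (l : ℤ)) := Nat.cast_injective
  have hj : Function.Injective (fun l : ℕ => (-(l + 1) : ℤ)) := fun x y h => by
    simp only at h
    omega
  rw [tsum_of_nat_of_neg_add_one (hp.comp_injective hi) (hp.comp_injective hj),
    tsum_of_nat_of_neg_add_one (hn.comp_injective hi) (hn.comp_injective hj), Theta2,
    tsum_eq_of_three_mul_add_two (summable_norm_Theta2Term t hq).of_norm fun l => by
      simp [Theta2Term, chi3_two_mod]]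
  have h1 : ∀ l : ℕ, Theta2Term t q (3 * l) = thetaPos t q l := fun l => by
    rw [Theta2Term, thetaPos, chi3_zero_mod, Int.cast_one, one_mul, ← zpow_natCast, ← zpow_natCast]
    congr 2
    push_cast
    ring
  have h2 : ∀ l : ℕ, Theta2Term t q (3 * l + 1) = -thetaNeg t q l := fun l => by
    rw [Theta2Term, thetaNeg, chi3_one_mod, Int.cast_neg, Int.cast_one, neg_one_mul, neg_mul,
      ← zpow_natCast, ← zpow_natCast]
    congr 3
    push_cast
    ring
  simp only [h1, h2, tsum_neg]
  ring

theorem hasSum_nat_even_odd {f : ℕ → ℂ} {s : ℂ} (hf : HasSum f s) :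
    HasSum (fun l : ℕ => f (2 * l) + f (2 * l + 1)) s := by
  have h1 := (hf.summable.comp_injective
    (show Function.Injective (fun l : ℕ => 2 * l) from fun x y h => by simpa using h)).hasSum
  have h2 := (hf.summable.comp_injective
    (show Function.Injective (fun l : ℕ => 2 * l + 1) from fun x y h => by simpa using h)).hasSum
  rw [hf.unique (h1.even_add_odd h2)]
  exact h1.add h2

/-- The `i`-th term of the false theta series of `hasSum_falseTheta` at `y = Q^n`, `Q = q³`. -/
theorem falseTheta_monomials {q : ℂ} (hq0 : q ≠ 0) (n : ℤ) (i : ℕ) :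
    (((q ^ 3) ^ n) ^ 3 * q ^ 3) ^ i * ((q ^ 3) ^ 3) ^ (i * i) *
        (1 - ((q ^ 3) ^ n) ^ 2 * (q ^ 3) ^ (4 * i + 2)) =
      q ^ (9 * n * i + 3 * i + 9 * i * i) - q ^ (9 * n * i + 15 * i + 9 * i * i + 6 * n + 6) := by
  simp only [← zpow_natCast, ← zpow_mul, ← zpow_add₀ hq0, mul_sub, mul_one]
  congr 2 <;> push_cast <;> ring

/-- The coefficientwise form of the theorem: the even-indexed terms of the false theta series come
from `Θ₁`, the odd-indexed ones from the terms of negative index that complete `Θ₂`. -/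
theorem hasSum_coeff {t q : ℂ} (ht : t ≠ 0) (hq0 : q ≠ 0) (hq : ‖q‖ < 1) :
    HasSum (fun n : ℤ => (t * q) ^ n * (q ^ 3) ^ (n * n) *
        ∑' j, coeffTerm ((q ^ 3) ^ n) ((q ^ 3) ^ 2) j)
      ((∑' n : ℤ, (t * q) ^ n * (q ^ 3) ^ (n * n)) * Theta1 t q -
        (∑' n, starTerm t q n) * (∑' l : ℕ, thetaPos t q (-(l + 1)) -
          ∑' l : ℕ, thetaNeg t q (-(l + 1)))) := by
  have hQ : ‖q ^ 3‖ < 1 := by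
    rw [norm_pow]
    exact pow_lt_one₀ (norm_nonneg q) hq three_ne_zero
  have hQ0 : q ^ 3 ≠ 0 := pow_ne_zero 3 hq0
  have hT := summable_norm_zpow_mul_zpow_sq (c := t * q) hQ
  have hE := summable_norm_starTerm ht hq0 hq
  have h1 := summable_norm_Theta1Term t hq
  have hj : Function.Injective (fun l : ℕ => (-(l + 1) : ℤ)) := fun x y h => by
    simp only at h
    omega
  have hs := ((hasSum_shear hT (h1.comp_injective
      (show Function.Injective (fun l : ℕ => 3 * l) from fun x y h => by simpa using h))
      (fun l => 3 * (l : ℤ))).add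
    (hasSum_shear hT (h1.comp_injective
      (show Function.Injective (fun l : ℕ => 3 * l + 1) from fun x y h => by simpa using h))
      (fun l => 3 * (l : ℤ) + 1))).sub
    ((hasSum_shear hE ((summable_norm_thetaPos ht hq0 hq).comp_injective hj)
      (fun l => 3 * (l : ℤ) + 3)).sub
    (hasSum_shear hE ((summable_norm_thetaNeg ht hq0 hq).comp_injective hj)
      (fun l => 3 * (l : ℤ) + 2)))
  rw [← mul_add, ← mul_sub] at hs
  rw [Theta1_eq t hq]
  refine hs.prod_fiberwise fun n => ?_
  have hy : ∀ j : ℕ, 1 + (q ^ 3) ^ n * ((q ^ 3) ^ 2) ^ j ≠ 0 := fun j => by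
    rw [← pow_mul, ← zpow_natCast (q ^ 3) (2 * j), ← zpow_add₀ hQ0]
    exact one_add_zpow_ne_zero hQ0 hQ _
  refine ((hasSum_nat_even_odd (hasSum_falseTheta hQ hy)).mul_left
    ((t * q) ^ n * (q ^ 3) ^ (n * n))).congr_fun fun l => ?_
  have hT' : ∀ m : ℤ, (t * q) ^ m * (q ^ 3) ^ (m * m) = t ^ m * q ^ (3 * m * m + m) := fun m => by
    rw [mul_zpow, ← zpow_natCast, ← zpow_mul, mul_assoc, ← zpow_add₀ hq0]
    congr 2
    push_cast
    ring
  have h3 : Theta1Term t q (3 * l) = t ^ (-(3 * l : ℤ)) * q ^ (3 * l * (3 * l + 1) : ℤ) := by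
    rw [Theta1Term, chi3_zero_mod, Int.cast_one, one_mul, ← zpow_natCast]
    push_cast
    rfl
  have h4 : Theta1Term t q (3 * l + 1) =
      -(t ^ (-(3 * l + 1 : ℤ)) * q ^ ((3 * l + 1) * (3 * l + 1 + 1) : ℤ)) := by
    rw [Theta1Term, chi3_one_mod, Int.cast_neg, Int.cast_one, neg_one_mul, neg_mul, ← zpow_natCast]
    push_cast
    rfl
  have h5 : ∀ x y u v : ℤ, t ^ x * q ^ y * (t ^ u * q ^ v) = t ^ (x + u) * q ^ (y + v) := by
    intro x y u v
    rw [zpow_add₀ ht, zpow_add₀ hq0]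
    ring
  have h6 : ∀ x y v : ℤ, t ^ x * q ^ y * q ^ v = t ^ x * q ^ (y + v) := by
    intro x y v
    rw [zpow_add₀ hq0]
    ring
  simp only [hT', h3, h4, falseTheta_monomials hq0, starTerm, thetaPos,
    thetaNeg, mul_neg, h5, mul_add (t ^ n * q ^ (3 * n * n + n)),
    mul_sub (t ^ n * q ^ (3 * n * n + n)), h6]
  rw [sub_sub_eq_add_sub, ← sub_eq_add_neg, add_sub_assoc]
  push_cast
  congr 1 <;> congr 1 <;> congr 2 <;> ring

end Capparelli

theorem theorem1p1 (t q : ℂ) (ht : t ≠ 0) (hq0 : q ≠ 0) (hq : ‖q‖ < 1) :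
    -- all the series involved converge absolutely
    (∀ m : ℕ, 1 ≤ m → Summable (fun p : Capparelli.GapPartition m => Capparelli.weight t q p)) ∧
    Summable (Capparelli.Theta1Term t q) ∧
    Summable (Capparelli.Theta2Term t q) ∧
    -- the two evaluations
    Capparelli.C 1 t q =
      Capparelli.qPochInf (-q ^ 3) (q ^ 3) * Capparelli.theta (-(t ^ 2 * q ^ 2)) (q ^ 6)
        + Capparelli.C 2 t q * (1 - Capparelli.Theta1 t q)
        + Capparelli.C2star t q * (1 - Capparelli.Theta2 t q) ∧
    Capparelli.C 3 t q =
      -(Capparelli.qPochInf (-q ^ 3) (q ^ 3) * Capparelli.theta (-(t ^ 2 * q ^ 2)) (q ^ 6))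
        + Capparelli.C 2 t q * Capparelli.Theta1 t q
        + Capparelli.C2star t q * Capparelli.Theta2 t q := by
  have hQ : ‖q ^ 3‖ < 1 := by
    rw [norm_pow]
    exact pow_lt_one₀ (norm_nonneg q) hq three_ne_zero
  have hQ0 : q ^ 3 ≠ 0 := pow_ne_zero 3 hq0
  have ha : t * q ≠ 0 := mul_ne_zero ht hq0
  have hb : t⁻¹ * q ^ 2 ≠ 0 := mul_ne_zero (inv_ne_zero ht) (pow_ne_zero 2 hq0)
  have hab : t * q * (t⁻¹ * q ^ 2) = q ^ 3 := by
    field_simp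
  obtain ⟨e3, e2, es⟩ := Capparelli.C_eq_sol ht hq0 hq
  have h2 := (Capparelli.solTwo_zero ha hQ0 hQ hab).tsum_eq
  have hs := (Capparelli.solTwo_zero hb hQ0 hQ ((mul_comm _ _).trans hab)).tsum_eq
  have h3 := (Capparelli.solThree_zero ha hQ0 hQ hab).unique
    ((Capparelli.hasSum_coeff ht hq0 hq).mul_left (Capparelli.qPochInf (-q ^ 3) (q ^ 3)))
  have hstar : ∑' n : ℤ, (t⁻¹ * q ^ 2) ^ n * (q ^ 3) ^ (n * n) =
      ∑' n, Capparelli.starTerm t q n := by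
    rw [← (Equiv.neg ℤ).tsum_eq]
    refine tsum_congr fun n => ?_
    rw [Equiv.neg_apply, Capparelli.starTerm, mul_zpow, inv_zpow', neg_neg, ← zpow_natCast,
      ← zpow_natCast, ← zpow_mul, ← zpow_mul, mul_assoc, ← zpow_add₀ hq0]
    congr 2
    push_cast
    ring
  have hprod := Capparelli.tsum_starTerm_mul ht hq0 hq
  have hth := Capparelli.Theta2_eq ht hq0 hq
  rw [tsum_mul_left] at h2 hs
  rw [hstar] at hs
  rw [← e3] at h3
  rw [← e2] at h2
  rw [← es] at hs
  have hW := Capparelli.qPochInf_self_ne_zero (Capparelli.norm_sq_lt_one hQ)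
  rw [← pow_mul] at h2 hs h3 hW
  have main : Capparelli.C 3 t q =
      -(Capparelli.qPochInf (-q ^ 3) (q ^ 3) * Capparelli.theta (-(t ^ 2 * q ^ 2)) (q ^ 6))
        + Capparelli.C 2 t q * Capparelli.Theta1 t q
        + Capparelli.C2star t q * Capparelli.Theta2 t q := by
    refine mul_left_cancel₀ hW ?_
    rw [h3]
    linear_combination Capparelli.Theta1 t q * h2 + Capparelli.Theta2 t q * hs
      - Capparelli.qPochInf (-q ^ 3) (q ^ 3) * hprod
      - Capparelli.qPochInf (-q ^ 3) (q ^ 3) * (∑' n, Capparelli.starTerm t q n) * hth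
  refine ⟨fun m hm => Capparelli.summable_weight ht hq hm,
    (Capparelli.summable_norm_Theta1Term t hq).of_norm,
    (Capparelli.summable_norm_Theta2Term t hq).of_norm, ?_, main⟩
  have hdef : Capparelli.C2star t q =
    Capparelli.C 1 t q - Capparelli.C 2 t q + Capparelli.C 3 t q := rfl
  linear_combination -main - hdef
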